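/- For $n\in\mathbb N$ let $\mathbb M_n$ be the $n\times n$ complex matrices and $\mathbb M_n^+$ the positive semidefinite ones; let $\|\cdot\|_\infty$ be the operator norm. A linear map between matrix algebras is positive if it sends positive semidefinite matrices to positive semidefinite matrices. For $0\le\alpha\le1$ and $X,Y\in\mathbb M_l^+$ the weighted geometric mean is $$X\,\#_\alpha\,Y=\lim_{\varepsilon\searrow0}(X+\varepsilon I)^{1/2}\bigl((X+\varepsilon I)^{-1/2}(Y+\varepsilon I)(X+\varepsilon I)^{-1/2}\bigr)^{\alpha}(X+\varepsilon I)^{1/2},$$ and $a\,\#_\alpha\,b=a^{1-\alpha}b^{\alpha}$ for real $a,b\ge0$ (with $0^0=1$). For $X\in\mathbb M_l^+$ let $\lambda(X)=(\lambda_1(X)\ge\dots\ge\lambda_l(X))$ be its eigenvalues in decreasing order with multiplicities, and $\lambda^r(X)=(\lambda_i(X)^r)_i$. For decreasing non-negative vectors $a,b$ of length $l$, the log-supermajorization $a\prec^{w(\log)}b$ means $\prod_{i=l+1-k}^{l}a_i\ge\prod_{i=l+1-k}^{l}b_i$ for all $1\le k\le l$. **Proposition 4.2.** Let $\Phi:\mathbb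 M_n\to\mathbb M_l$ and $\Psi:\mathbb M_m\to\mathbb M_l$ be positive linear maps and let $0\le\alpha\le1$. Then for every $A\in\mathbb M_n^+$ and $B\in\mathbb M_m^+$, $$\bigl(\|\Phi(I_n)\|_\infty\,\#_\alpha\,\|\Psi(I_m)\|_\infty\bigr)^{r-1}\,\lambda\bigl(\Phi(A^r)\,\#_\alpha\,\Psi(B^r)\bigr)\prec^{w(\log)}\lambda^r\bigl(\Phi(A)\,\#_\alpha\,\Psi(B)\bigr)$$ for all real $r\ge1$. Consequently, if $\|\Phi(I_n)\|_\infty\,\#_\alpha\,\|\Psi(I_m)\|_\infty\le1$, then $$\lambda\bigl(\Phi(A^r)\,\#_\alpha\,\Psi(B^r)\bigr)\prec^{w(\log)}\lambda^r\bigl(\Phi(A)\,\#_\alpha\,\Psi(B)\bigr),\qquad r\ge1.$$ -/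

import Mathlib

open Filter Topology
open scoped MatrixOrder ComplexOrder Matrix.Norms.L2Operator

section
variable {A : Type*} [CStarAlgebra A] [PartialOrder A] [StarOrderedRing A]


/-- The weighted geometric mean `a #_α b = a^{1/2} (a^{-1/2} b a^{-1/2})^α a^{1/2}` for strictly
positive `a`; real powers are those of the continuous functional calculus. -/
noncomputable def strictGeomMean (α : ℝ) (a b : A) : A :=
  a ^ (1 / 2 : ℝ) * (a ^ (-(1 / 2) : ℝ) * b * a ^ (-(1 / 2) : ℝ)) ^ α * a ^ (1 / 2 : ℝ)

theorem strictGeomMean_mono_right {α : ℝ} (hα : α ∈ Set.Icc (0:ℝ) 1) (a : A) {b c : A} (h : b ≤ c) :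
    strictGeomMean α a b ≤ strictGeomMean α a c := by
  unfold strictGeomMean
  refine IsSelfAdjoint.conjugate_le_conjugate (CFC.rpow_le_rpow hα
    (IsSelfAdjoint.conjugate_le_conjugate h ?_)) ?_
  · exact CFC.rpow_nonneg.isSelfAdjoint
  · exact CFC.rpow_nonneg.isSelfAdjoint

theorem rpow_unitary_conjugate (u : unitary A) (a : A) (ha : IsStrictlyPositive a) (p : ℝ) :
    ((u : A) * a * star (u : A)) ^ p = (u : A) * a ^ p * star (u : A) := by
  have h0 : 0 ∉ spectrum ℝ a := spectrum.zero_notMem _ ha.isUnit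
  have hsa : IsSelfAdjoint a := ha.nonneg.isSelfAdjoint
  have hc : 0 ≤ (u : A) * a * star (u : A) := star_right_conjugate_nonneg ha.nonneg _
  rw [CFC.rpow_eq_cfc_real hc, CFC.rpow_eq_cfc_real ha.nonneg]
  have := StarAlgHomClass.map_cfc (R := ℝ) (S := ℂ) (Unitary.conjStarAlgAut ℂ A u) (fun x : ℝ => x ^ p) a
    (ContinuousOn.rpow_const (f := id) (by fun_prop) (fun x hx => Or.inl (by rintro rfl; exact h0 hx)))
    ?_ hsa ?_
  · simpa [Unitary.conjStarAlgAut_apply] using this.symm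
  · change Continuous fun x : A => (u : A) * x * star (u : A)
    fun_prop
  · simpa [Unitary.conjStarAlgAut_apply] using hc.isSelfAdjoint

/-- The symmetry `a #_α b = b #_{1-α} a`. -/
theorem strictGeomMean_comm (α : ℝ) (a b : A) (ha : IsStrictlyPositive a) (hb : IsStrictlyPositive b) :
    strictGeomMean α a b = strictGeomMean (1 - α) b a := by
  unfold strictGeomMean
  have hs0 : IsSelfAdjoint (a ^ (-(1 / 2) : ℝ)) := CFC.rpow_nonneg.isSelfAdjoint
  have ht0 : IsSelfAdjoint (b ^ (1 / 2 : ℝ)) := CFC.rpow_nonneg.isSelfAdjoint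
  have hss : a ^ (1 / 2 : ℝ) * a ^ (1 / 2 : ℝ) = a := by
    rw [← CFC.rpow_add ha.isUnit, add_halves, CFC.rpow_one a ha.nonneg]
  have hss' : a ^ (1 / 2 : ℝ) * a ^ (-(1 / 2) : ℝ) = 1 := CFC.rpow_mul_rpow_neg _ ha
  have hs's : a ^ (-(1 / 2) : ℝ) * a ^ (1 / 2 : ℝ) = 1 := CFC.rpow_neg_mul_rpow _ ha
  have htt : b ^ (1 / 2 : ℝ) * b ^ (1 / 2 : ℝ) = b := by
    rw [← CFC.rpow_add hb.isUnit, add_halves, CFC.rpow_one b hb.nonneg]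
  have htt' : b ^ (1 / 2 : ℝ) * b ^ (-(1 / 2) : ℝ) = 1 := CFC.rpow_mul_rpow_neg _ hb
  have ht't : b ^ (-(1 / 2) : ℝ) * b ^ (1 / 2 : ℝ) = 1 := CFC.rpow_neg_mul_rpow _ hb
  have hCnn : 0 ≤ a ^ (-(1 / 2) : ℝ) * b * a ^ (-(1 / 2) : ℝ) :=
    hs0.conjugate_nonneg hb.nonneg
  have hCu : IsUnit (a ^ (-(1 / 2) : ℝ) * b * a ^ (-(1 / 2) : ℝ)) :=
    ((ha.isUnit.cfcRpow _ ha.nonneg).mul hb.isUnit).mul (ha.isUnit.cfcRpow _ ha.nonneg)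
  set s := a ^ (1 / 2 : ℝ)
  set s' := a ^ (-(1 / 2) : ℝ)
  set t := b ^ (1 / 2 : ℝ)
  set t' := b ^ (-(1 / 2) : ℝ)
  obtain ⟨C, hC⟩ : ∃ C, C = s' * b * s' := ⟨_, rfl⟩
  rw [← hC] at hCnn hCu ⊢
  have hCsp : IsStrictlyPositive C := hCu.isStrictlyPositive hCnn
  have hc0 : IsSelfAdjoint (C ^ (-(1 / 2) : ℝ)) := CFC.rpow_nonneg.isSelfAdjoint
  have hadd (x y : ℝ) : C ^ x * C ^ y = C ^ (x + y) := (CFC.rpow_add hCu).symm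
  have hC1 : C ^ (1 : ℝ) = C := CFC.rpow_one C hCnn
  have hinv : C ^ (-1 : ℝ) = s * t' * t' * s := by
    have h1 : C * (s * t' * t' * s) = 1 := by
      rw [hC, ← htt]
      calc s' * (t * t) * s' * (s * t' * t' * s)
          = s' * t * (t * (s' * s) * t') * t' * s := by noncomm_ring
        _ = s' * (t * t') * s := by rw [hs's, mul_one, htt', mul_one, mul_assoc s' t t', htt']
        _ = 1 := by rw [htt', mul_one, hs's]
    have h2 : C ^ (-1 : ℝ) * C = 1 := by
      nth_rewrite 2 [← hC1]
      rw [hadd]; norm_num; exact CFC.rpow_zero C hCnn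
    calc C ^ (-1 : ℝ) = C ^ (-1 : ℝ) * (C * (s * t' * t' * s)) := by rw [h1, mul_one]
      _ = _ := by rw [← mul_assoc, h2, one_mul]
  have hU : t * s' * C ^ (-(1 / 2) : ℝ) ∈ unitary A := by
    rw [Unitary.mem_iff, star_mul, star_mul, hs0.star_eq, ht0.star_eq, hc0.star_eq]
    constructor
    · calc C ^ (-(1 / 2) : ℝ) * (s' * t) * (t * s' * C ^ (-(1 / 2) : ℝ))
          = C ^ (-(1 / 2) : ℝ) * (s' * (t * t) * s') * C ^ (-(1 / 2) : ℝ) := by noncomm_ring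
        _ = C ^ (-(1 / 2) : ℝ) * C ^ (1 : ℝ) * C ^ (-(1 / 2) : ℝ) := by rw [htt, ← hC, hC1]
        _ = 1 := by rw [hadd, hadd]; norm_num; exact CFC.rpow_zero C hCnn
    · calc t * s' * C ^ (-(1 / 2) : ℝ) * (C ^ (-(1 / 2) : ℝ) * (s' * t))
          = t * s' * (C ^ (-(1 / 2) : ℝ) * C ^ (-(1 / 2) : ℝ)) * s' * t := by noncomm_ring
        _ = t * s' * C ^ (-1 : ℝ) * s' * t := by rw [hadd]; norm_num
        _ = t * (s' * s) * t' * t' * (s * s') * t := by rw [hinv]; noncomm_ring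
        _ = (t * t') * (t' * t) := by rw [hs's, hss']; noncomm_ring
        _ = 1 := by rw [htt', ht't, one_mul]
  have hD : t' * a * t' = (t * s' * C ^ (-(1 / 2) : ℝ)) * C ^ (-1 : ℝ) *
      star (t * s' * C ^ (-(1 / 2) : ℝ)) := by
    rw [star_mul, star_mul, hs0.star_eq, ht0.star_eq, hc0.star_eq]
    symm
    calc t * s' * C ^ (-(1 / 2) : ℝ) * C ^ (-1 : ℝ) * (C ^ (-(1 / 2) : ℝ) * (s' * t))
        = t * s' * (C ^ (-(1 / 2) : ℝ) * C ^ (-1 : ℝ) * C ^ (-(1 / 2) : ℝ)) * s' * t := by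
          noncomm_ring
      _ = t * s' * (C ^ (-1 : ℝ) * C ^ (-1 : ℝ)) * s' * t := by
          rw [hadd, hadd, hadd]; norm_num
      _ = (t * (s' * s) * t') * t' * s * s * t' * (t' * (s * s') * t) := by
          rw [hinv]; noncomm_ring
      _ = t' * a * t' := by rw [hs's, hss', mul_one, mul_one, htt', ht't, ← hss]; noncomm_ring
  have hCinv : IsStrictlyPositive (C ^ (-1 : ℝ)) :=
    (hCu.cfcRpow _ hCnn).isStrictlyPositive CFC.rpow_nonneg
  have hpow := rpow_unitary_conjugate ⟨_, hU⟩ _ hCinv (1 - α)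
  simp only [← hD] at hpow
  have hsb : s' * b = C * s := by rw [hC, mul_assoc, hs's, mul_one]
  have hbs : b * s' = s * C := by
    rw [hC, mul_assoc, ← mul_assoc s, hss', one_mul]
  rw [hpow, CFC.rpow_rpow C _ _ (by norm_num) hCsp, star_mul, star_mul, hs0.star_eq,
    ht0.star_eq, hc0.star_eq]
  symm
  calc t * (t * s' * C ^ (-(1 / 2) : ℝ) * C ^ (-1 * (1 - α)) * (C ^ (-(1 / 2) : ℝ) * (s' * t))) * t
      = ((t * t) * s') * (C ^ (-(1 / 2) : ℝ) * C ^ (-1 * (1 - α)) * C ^ (-(1 / 2) : ℝ)) *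
          (s' * (t * t)) := by noncomm_ring
    _ = s * (C ^ (1 : ℝ) * (C ^ (-(1 / 2) : ℝ) * C ^ (-1 * (1 - α)) * C ^ (-(1 / 2) : ℝ)) *
          C ^ (1 : ℝ)) * s := by rw [htt, hsb, hbs, hC1]; noncomm_ring
    _ = s * C ^ α * s := by rw [hadd, hadd, hadd, hadd]; congr 3; ring

theorem strictGeomMean_mono {α : ℝ} (hα : α ∈ Set.Icc (0 : ℝ) 1) {a b c d : A}
    (ha : IsStrictlyPositive a) (_hb : IsStrictlyPositive b) (hc : IsStrictlyPositive c)
    (hd : IsStrictlyPositive d) (hac : a ≤ c) (hbd : b ≤ d) : strictGeomMean α a b ≤ strictGeomMean α c d := by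
  refine (strictGeomMean_mono_right hα a hbd).trans ?_
  rw [strictGeomMean_comm α a d ha hd, strictGeomMean_comm α c d hc hd]
  exact strictGeomMean_mono_right ⟨by linarith [hα.2], by linarith [hα.1]⟩ d hac

end
variable {n : Type*} [Fintype n] [DecidableEq n]

/-- The weighted geometric mean `A #_α B` of arbitrary positive semidefinite matrices, namely
`lim_{ε ↘ 0} (A + ε I) #_α (B + ε I)`. That the limit exists for `0 ≤ α ≤ 1` is
`tendsto_weightedGeomMean` below. -/
noncomputable def weightedGeomMean (α : ℝ) (A B : Matrix n n ℂ) : Matrix n n ℂ :=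
  limUnder (𝓝[>] (0 : ℝ)) fun ε => strictGeomMean α (A + ε • 1) (B + ε • 1)

theorem exists_tendsto_of_monotone_nonneg (g : ℝ → Matrix n n ℂ) (h0 : ∀ ε, 0 < ε → 0 ≤ g ε)
    (hg : ∀ ε δ, 0 < ε → ε ≤ δ → g ε ≤ g δ) : ∃ L, Tendsto g (𝓝[>] (0 : ℝ)) (𝓝 L) := by
  have : ProperSpace (Matrix n n ℂ) := FiniteDimensional.proper ℂ _
  have hK : IsCompact (Set.Icc 0 (g 1)) := by
    refine Metric.isCompact_of_isClosed_isBounded isClosed_Icc ?_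
    refine (Metric.isBounded_closedBall (x := (0 : Matrix n n ℂ)) (r := ‖g 1‖)).subset ?_
    intro x hx
    rw [mem_closedBall_zero_iff]
    exact CStarAlgebra.norm_le_norm_of_nonneg_of_le hx.1 hx.2
  have hmem : ∀ᶠ ε in 𝓝[>] (0 : ℝ), g ε ∈ Set.Icc 0 (g 1) := by
    filter_upwards [Ioc_mem_nhdsGT (zero_lt_one (α := ℝ))] with ε hε
    exact ⟨h0 ε hε.1, hg ε 1 hε.1 hε.2⟩
  have hle : map g (𝓝[>] (0 : ℝ)) ≤ 𝓟 (Set.Icc 0 (g 1)) := tendsto_principal.2 hmem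
  obtain ⟨L, -, hL⟩ := hK hle
  have key : ∀ M, ClusterPt M (map g (𝓝[>] (0 : ℝ))) → ∀ ε, 0 < ε → M ≤ g ε := by
    intro M hM ε hε
    change M ∈ Set.Iic (g ε)
    refine isClosed_Iic.mem_of_frequently_of_tendsto (b := map g (𝓝[>] (0 : ℝ)) ⊓ 𝓝 M)
      (f := id) ?_ (tendsto_id.mono_left inf_le_right)
    have : (map g (𝓝[>] (0 : ℝ)) ⊓ 𝓝 M).NeBot := by rw [inf_comm]; exact hM
    refine Eventually.frequently (Eventually.filter_mono inf_le_left ?_)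
    refine eventually_map.2 ?_
    filter_upwards [Ioc_mem_nhdsGT hε] with δ hδ
    exact hg δ ε hδ.1 hδ.2
  have key2 : ∀ M N, ClusterPt M (map g (𝓝[>] (0 : ℝ))) →
      ClusterPt N (map g (𝓝[>] (0 : ℝ))) → M ≤ N := by
    intro M N hM hN
    change N ∈ Set.Ici M
    refine isClosed_Ici.mem_of_frequently_of_tendsto (b := map g (𝓝[>] (0 : ℝ)) ⊓ 𝓝 N)
      (f := id) ?_ (tendsto_id.mono_left inf_le_right)
    have : (map g (𝓝[>] (0 : ℝ)) ⊓ 𝓝 N).NeBot := by rw [inf_comm]; exact hN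
    refine Eventually.frequently (Eventually.filter_mono inf_le_left ?_)
    refine eventually_map.2 ?_
    filter_upwards [self_mem_nhdsWithin] with δ hδ
    exact key M hM δ hδ
  exact ⟨L, hK.le_nhds_of_unique_clusterPt (le_principal_iff.1 hle) fun M _ hM =>
    le_antisymm (key2 M L hM hL) (key2 L M hL hM)⟩

/-- The limit defining `A #_α B` exists. -/
theorem tendsto_weightedGeomMean {α : ℝ} (hα : α ∈ Set.Icc (0 : ℝ) 1) {A B : Matrix n n ℂ}
    (hA : A.PosSemidef) (hB : B.PosSemidef) :
    Tendsto (fun ε : ℝ => strictGeomMean α (A + ε • 1) (B + ε • 1)) (𝓝[>] 0) (𝓝 (weightedGeomMean α A B)) := by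
  have hpos : ∀ {X : Matrix n n ℂ}, X.PosSemidef → ∀ ε : ℝ, 0 < ε →
      IsStrictlyPositive (X + ε • 1) := fun hX ε hε =>
    Matrix.isStrictlyPositive_iff_posDef.2 (Matrix.PosDef.posSemidef_add hX (Matrix.PosDef.one.smul hε))
  have hmono : ∀ (X : Matrix n n ℂ) (ε δ : ℝ), ε ≤ δ → X + ε • 1 ≤ X + δ • 1 := by
    intro X ε δ h
    have := smul_le_smul_of_nonneg_right h (zero_le_one (α := Matrix n n ℂ))
    gcongr
  refine tendsto_nhds_limUnder (exists_tendsto_of_monotone_nonneg _ ?_ ?_)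
  · intro ε hε
    exact (CFC.rpow_nonneg.isSelfAdjoint).conjugate_nonneg CFC.rpow_nonneg
  · intro ε δ hε h
    exact strictGeomMean_mono hα (hpos hA ε hε) (hpos hB ε hε) (hpos hA δ (hε.trans_le h))
      (hpos hB δ (hε.trans_le h)) (hmono A ε δ h) (hmono B ε δ h)

theorem posSemidef_weightedGeomMean {α : ℝ} (hα : α ∈ Set.Icc (0 : ℝ) 1) {A B : Matrix n n ℂ}
    (hA : A.PosSemidef) (hB : B.PosSemidef) : (weightedGeomMean α A B).PosSemidef := by
  rw [← Matrix.nonneg_iff_posSemidef]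
  refine ge_of_tendsto' (tendsto_weightedGeomMean hα hA hB) fun ε => ?_
  exact (CFC.rpow_nonneg.isSelfAdjoint).conjugate_nonneg CFC.rpow_nonneg

/-- The weighted geometric mean `a #_α b = a^{1-α} b^α` of two non-negative numbers
(with `0^0 = 1`). -/
noncomputable def scalarGeomMean (α a b : ℝ) : ℝ := a ^ (1 - α) * b ^ α

/-- For non-negative numbers the closed formula is the limit that defines an operator mean. -/
theorem tendsto_scalarGeomMean {α a b : ℝ} (hα : α ∈ Set.Icc (0 : ℝ) 1) (ha : 0 ≤ a)
    (hb : 0 ≤ b) :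
    Tendsto (fun ε : ℝ => (a + ε) * ((b + ε) / (a + ε)) ^ α) (𝓝[>] 0)
      (𝓝 (scalarGeomMean α a b)) := by
  have h1 : ContinuousAt (fun ε : ℝ => (a + ε) ^ (1 - α) * (b + ε) ^ α) 0 :=
    ((continuousAt_const.add continuousAt_id).rpow_const (Or.inr (by linarith [hα.2]))).mul
      ((continuousAt_const.add continuousAt_id).rpow_const (Or.inr hα.1))
  have h2 := h1.tendsto.mono_left (nhdsWithin_le_nhds (s := Set.Ioi 0))
  simp only [add_zero] at h2
  refine h2.congr' ?_
  filter_upwards [self_mem_nhdsWithin] with ε hε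
  have hε' : (0 : ℝ) < ε := hε
  have hpa : 0 < a + ε := by linarith
  have hpb : 0 ≤ b + ε := by linarith
  rw [Real.div_rpow hpb hpa.le, Real.rpow_sub hpa, Real.rpow_one]
  ring

open Classical in
/-- The eigenvalues of a Hermitian matrix in decreasing order, counted with multiplicities (and
the zero vector for a matrix that is not Hermitian). -/
noncomputable def eigenvaluesDesc (X : Matrix n n ℂ) : Fin (Fintype.card n) → ℝ :=
  if h : X.IsHermitian then h.eigenvalues₀ else 0

theorem eigenvaluesDesc_eq {X : Matrix n n ℂ} (h : X.IsHermitian) :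
    eigenvaluesDesc X = h.eigenvalues₀ := dif_pos h

/-- `a` is log-supermajorized by `b`, for decreasing non-negative vectors `a`, `b` of length `N`:
for each `1 ≤ k ≤ N` the product of the last `k` entries of `a` is at least that of `b`. -/
def LogSupermajorizedBy {N : ℕ} (a b : Fin N → ℝ) : Prop :=
  ∀ k : ℕ, 1 ≤ k → k ≤ N →
    ∏ i ∈ Finset.univ.filter (fun i : Fin N => N - k ≤ (i : ℕ)), b i ≤
      ∏ i ∈ Finset.univ.filter (fun i : Fin N => N - k ≤ (i : ℕ)), a i

/-! ### Weighted geometric means of invertible elements and the Ando-Hiai inequality -/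

section StrictGeomMean
variable {A : Type*} [CStarAlgebra A] [PartialOrder A] [StarOrderedRing A]

/-! Write `c = a #_α b` for positive constants with `Φ 1 ≤ a`, `Ψ 1 ≤ b`. Operator Jensen for the
power `1/r`, applied to `A ^ r`, gives `Φ A ≤ a (a⁻¹ Φ (A ^ r))^{1/r}`, and likewise for `Ψ`. Let
`X`, `Y` be `Φ (A ^ r)`, `Ψ (B ^ r)` plus `ε`, and put `U = (a⁻¹ X)^{1/r}`, `V = (b⁻¹ Y)^{1/r}`.
Monotonicity and homogeneity of the mean yield `Φ A #_α Ψ B ≤ c (U #_α V)`.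

The product of the `k` smallest eigenvalues of a positive matrix is the smallest eigenvalue of its
`k`-th compound. Compounds are multiplicative, commute with real powers of positive matrices and are
monotone on them, so they commute with geometric means. Thus, if `m > 0` is this product for `Φ A
#_α Ψ B`, then `c^{-k} m` bounds from below the mean of the compounds of `U` and `V`.

Ando-Hiai raises this bound to the power `r`: `(c^{-k} m)^r` is a lower bound for the compound of
`U^r #_α V^r = c⁻¹ (X #_α Y)`. Hence `m^r ≤ c^{k(r-1)}` times the compound of `X #_α Y`. Letting `ε
→ 0`, and then letting `a`, `b` decrease to the norms, gives the inequality for each `k`; the case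
`m = 0` is trivial.

The carrying lemmas are `one_le_strictGeomMean_rpow`, `compound_strictGeomMean`,
`Matrix.compound_mono` and `PositiveLinearMap.apply_rpow_le`. -/

theorem IsStrictlyPositive.cfc_rpow {a : A} (ha : IsStrictlyPositive a) (p : ℝ) :
    IsStrictlyPositive (a ^ p) :=
  (ha.isUnit.cfcRpow p ha.nonneg).isStrictlyPositive CFC.rpow_nonneg

theorem IsStrictlyPositive.conjugate {a s : A} (ha : IsStrictlyPositive a)
    (hs : IsStrictlyPositive s) : IsStrictlyPositive (s * a * s) :=
  ((hs.isUnit.mul ha.isUnit).mul hs.isUnit).isStrictlyPositive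
    (hs.nonneg.isSelfAdjoint.conjugate_nonneg ha.nonneg)

theorem IsStrictlyPositive.pos_smul {a : A} (ha : IsStrictlyPositive a) {c : ℝ} (hc : 0 < c) :
    IsStrictlyPositive (c • a) :=
  have hu : IsUnit (c • a) := (isUnit_smul_iff (Units.mk0 c hc.ne') a).2 ha.isUnit
  hu.isStrictlyPositive (smul_nonneg hc.le ha.nonneg)

theorem isStrictlyPositive_strictGeomMean {a b : A} {α : ℝ} (ha : IsStrictlyPositive a)
    (hb : IsStrictlyPositive b) : IsStrictlyPositive (strictGeomMean α a b) :=
  ((hb.conjugate (ha.cfc_rpow _)).cfc_rpow α).conjugate (ha.cfc_rpow _)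

/-- Invertibility keeps 0 out of the spectrum, so the power function is continuous there even for
negative `p`. -/
theorem cfc_smul_rpow {a : A} (ha : 0 ≤ a) {c : ℝ} (hc : 0 < c) (hu : IsUnit a) (p : ℝ) :
    (c • a) ^ p = c ^ p • a ^ p := by
  have hsp := hu.isStrictlyPositive ha
  have h0 : (0 : ℝ) ∉ spectrum ℝ a := spectrum.zero_notMem _ hu
  rw [CFC.rpow_eq_cfc_real (smul_nonneg hc.le ha), CFC.rpow_eq_cfc_real ha]
  have hcont : ContinuousOn (fun x : ℝ => x ^ p) (spectrum ℝ a) := 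
    ContinuousOn.rpow_const (f := id) (by fun_prop)
      (fun x hx => Or.inl (by rintro rfl; exact h0 hx))
  have hcont' : ContinuousOn (fun x : ℝ => x ^ p) ((c • ·) '' spectrum ℝ a) := by
    refine ContinuousOn.rpow_const (f := id) (by fun_prop) ?_
    rintro _ ⟨x, hx, rfl⟩
    refine Or.inl (mul_ne_zero hc.ne' ?_)
    rintro rfl; exact h0 hx
  rw [← cfc_comp_smul c (fun x : ℝ => x ^ p) a hcont', ← cfc_smul _ _ _ hcont]
  refine cfc_congr fun x hx => ?_
  exact Real.mul_rpow hc.le (spectrum_nonneg_of_nonneg ha hx)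

/-- Joint homogeneity: it normalises the lower bound to 1 for Ando-Hiai, and it produces the scalar
mean of the norms in the final estimate. -/
theorem strictGeomMean_smul (α : ℝ) {a b : A} (ha : IsStrictlyPositive a)
    (hb : IsStrictlyPositive b) {s t : ℝ} (hs : 0 < s) (ht : 0 < t) :
    strictGeomMean α (s • a) (t • b) = scalarGeomMean α s t • strictGeomMean α a b := by
  have hc := hb.conjugate (ha.cfc_rpow (-(1 / 2)))
  unfold strictGeomMean scalarGeomMean
  rw [cfc_smul_rpow ha.nonneg hs ha.isUnit, cfc_smul_rpow ha.nonneg hs ha.isUnit]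
  simp only [smul_mul_assoc, mul_smul_comm, smul_smul]
  have hss : 0 < s ^ (-(1 / 2) : ℝ) * (t * s ^ (-(1 / 2) : ℝ)) := by positivity
  rw [cfc_smul_rpow hc.nonneg hss hc.isUnit]
  simp only [smul_mul_assoc, mul_smul_comm, smul_smul]
  congr 1
  rw [Real.mul_rpow (by positivity) (by positivity), Real.mul_rpow (by positivity) (by positivity),
    ← Real.rpow_mul hs.le]
  calc _ = s ^ (1/2 : ℝ) * s ^ (1/2 : ℝ) * s ^ (-(1 / 2) * α : ℝ) * s ^ (-(1 / 2) * α : ℝ) * t ^ α := by ring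
    _ = _ := by
      rw [← Real.rpow_add hs, ← Real.rpow_add hs, ← Real.rpow_add hs]; congr 2; ring

theorem strictGeomMean_rpow_rpow (α p q : ℝ) {c : A} (hc : IsStrictlyPositive c) :
    strictGeomMean α (c ^ p) (c ^ q) = c ^ ((1 - α) * p + α * q) := by
  unfold strictGeomMean
  by_cases hp : p = 0
  · subst hp
    by_cases hq : q = 0
    · subst hq
      simp [CFC.rpow_zero c hc.nonneg]
    · simp [CFC.rpow_zero c hc.nonneg, CFC.rpow_rpow c q α hq hc, mul_comm]
  · rw [CFC.rpow_rpow c _ _ hp hc, CFC.rpow_rpow c _ _ hp hc, ← CFC.rpow_add hc.isUnit,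
      ← CFC.rpow_add hc.isUnit]
    -- This exponent is `q - p`; when it vanishes the middle factor is 1 and the rule for iterated
    -- powers is not available.
    by_cases hz : p * -(1 / 2) + q + p * -(1 / 2) = 0
    · rw [hz, CFC.rpow_zero c hc.nonneg, CFC.one_rpow, mul_one, ← CFC.rpow_add hc.isUnit]
      congr 1; obtain rfl : q = p := by linarith
      ring
    · rw [CFC.rpow_rpow c _ _ hz hc, ← CFC.rpow_add hc.isUnit, ← CFC.rpow_add hc.isUnit]
      congr 1; ring

/-- The Ando-Hiai inequality for exponents in `[1, 2]`. -/
theorem one_le_strictGeomMean_rpow_of_le_two {α : ℝ} (hα : α ∈ Set.Icc (0 : ℝ) 1) {x y : A}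
    (hx : IsStrictlyPositive x) (hy : IsStrictlyPositive y) (h : 1 ≤ strictGeomMean α x y)
    {r : ℝ} (hr : r ∈ Set.Icc (1 : ℝ) 2) : 1 ≤ strictGeomMean α (x ^ r) (y ^ r) := by
  have hsps := hx.cfc_rpow (1 / 2)
  have hsps' := hx.cfc_rpow (-(1 / 2))
  have hadd (p q : ℝ) : x ^ p * x ^ q = x ^ (p + q) := (CFC.rpow_add hx.isUnit).symm
  have hss : x ^ (1 / 2 : ℝ) * x ^ (1 / 2 : ℝ) = x := by
    rw [hadd, add_halves, CFC.rpow_one x hx.nonneg]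
  have hss' : x ^ (1 / 2 : ℝ) * x ^ (-(1 / 2) : ℝ) = 1 := CFC.rpow_mul_rpow_neg _ hx
  have hs's : x ^ (-(1 / 2) : ℝ) * x ^ (1 / 2 : ℝ) = 1 := CFC.rpow_neg_mul_rpow _ hx
  obtain ⟨c, hc⟩ : ∃ c, c = x ^ (-(1 / 2) : ℝ) * y * x ^ (-(1 / 2) : ℝ) := ⟨_, rfl⟩
  have hcp : IsStrictlyPositive c := hc ▸ hy.conjugate hsps'
  have hcadd (p q : ℝ) : c ^ p * c ^ q = c ^ (p + q) := (CFC.rpow_add hcp.isUnit).symm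
  have hyadd (p q : ℝ) : y ^ p * y ^ q = y ^ (p + q) := (CFC.rpow_add hy.isUnit).symm
  have hc1 : c ^ (1 : ℝ) = c := CFC.rpow_one c hcp.nonneg
  have hy1 : y ^ (1 : ℝ) = y := CFC.rpow_one y hy.nonneg
  -- the hypothesis bounds `x` below by a power of `c`
  have hle1 : x ^ (-1 : ℝ) ≤ c ^ α := by
    have h1 := hsps'.nonneg.isSelfAdjoint.conjugate_le_conjugate h
    unfold strictGeomMean at h1
    rw [← hc, mul_one, hadd] at h1
    calc x ^ (-1 : ℝ) = x ^ (-(1 / 2) + -(1 / 2) : ℝ) := by norm_num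
      _ ≤ _ := h1
      _ = (x ^ (-(1 / 2) : ℝ) * x ^ (1 / 2 : ℝ)) * c ^ α * (x ^ (1 / 2 : ℝ) * x ^ (-(1 / 2) : ℝ)) := by
        noncomm_ring
      _ = _ := by rw [hss', hs's]; simp
  have hle : c ^ (-α) ≤ x := by
    have h1 := CStarAlgebra.rpow_neg_one_le_rpow_neg_one hle1 (hx.cfc_rpow _)
    rw [CFC.rpow_rpow x _ _ (by norm_num) hx] at h1
    norm_num at h1
    rw [CFC.rpow_one x hx.nonneg] at h1
    by_cases h0 : α = 0
    · subst h0; simpa [CFC.rpow_zero c hcp.nonneg] using h1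
    · rwa [CFC.rpow_rpow c _ _ h0 hcp, mul_neg_one] at h1
  -- `x^{-1/2} y^r x^{-1/2} = c (x #_{2-r} c⁻¹) c`
  have hyinv : x ^ (-(1 / 2) : ℝ) * c ^ (-1 : ℝ) * x ^ (-(1 / 2) : ℝ) = y ^ (-1 : ℝ) := by
    have hcy : x ^ (1 / 2 : ℝ) * c * x ^ (1 / 2 : ℝ) = y := by
      rw [hc]
      calc _ = (x ^ (1 / 2 : ℝ) * x ^ (-(1 / 2) : ℝ)) * y * (x ^ (-(1 / 2) : ℝ) * x ^ (1 / 2 : ℝ)) := by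
            noncomm_ring
        _ = y := by rw [hss', hs's]; simp
    have h1 : (x ^ (-(1 / 2) : ℝ) * c ^ (-1 : ℝ) * x ^ (-(1 / 2) : ℝ)) * y = 1 := by
      rw [← hcy]
      calc _ = x ^ (-(1 / 2) : ℝ) * c ^ (-1 : ℝ) * (x ^ (-(1 / 2) : ℝ) * x ^ (1 / 2 : ℝ)) * c * x ^ (1 / 2 : ℝ) := by
            noncomm_ring
        _ = x ^ (-(1 / 2) : ℝ) * (c ^ (-1 : ℝ) * c ^ (1 : ℝ)) * x ^ (1 / 2 : ℝ) := by
            rw [hs's, hc1]; noncomm_ring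
        _ = 1 := by rw [hcadd]; norm_num [CFC.rpow_zero c hcp.nonneg, hs's]
    have h2 : y * y ^ (-1 : ℝ) = 1 := by
      nth_rewrite 1 [← hy1]
      rw [hyadd]; norm_num [CFC.rpow_zero y hy.nonneg]
    calc _ = (x ^ (-(1 / 2) : ℝ) * c ^ (-1 : ℝ) * x ^ (-(1 / 2) : ℝ)) * (y * y ^ (-1 : ℝ)) := by
            rw [h2, mul_one]
      _ = _ := by rw [← mul_assoc, h1, one_mul]
  have hd : x ^ (-(1 / 2) : ℝ) * y ^ r * x ^ (-(1 / 2) : ℝ) =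
      c * strictGeomMean (2 - r) x (c ^ (-1 : ℝ)) * c := by
    unfold strictGeomMean
    rw [hyinv, CFC.rpow_rpow y _ _ (by norm_num) hy]
    have e1 : c * x ^ (1 / 2 : ℝ) = x ^ (-(1 / 2) : ℝ) * y := by
      rw [hc, mul_assoc, hs's, mul_one]
    have e2 : x ^ (1 / 2 : ℝ) * c = y * x ^ (-(1 / 2) : ℝ) := by
      rw [hc, mul_assoc, ← mul_assoc (x ^ (1 / 2 : ℝ)), hss', one_mul]
    symm
    calc _ = (c * x ^ (1 / 2 : ℝ)) * y ^ (-1 * (2 - r)) * (x ^ (1 / 2 : ℝ) * c) := by noncomm_ring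
      _ = x ^ (-(1 / 2) : ℝ) * (y ^ (1 : ℝ) * y ^ (-1 * (2 - r)) * y ^ (1 : ℝ)) * x ^ (-(1 / 2) : ℝ) := by
        rw [e1, e2, hy1]; noncomm_ring
      _ = _ := by rw [hyadd, hyadd]; congr 3; ring
  -- Here `r ≤ 2` matters: `2 - r` must be a weight in `[0, 1]` for the mean to be monotone.
  -- Replacing `x` by `c ^ (-α)` leaves only powers of `c`.
  have hdge : c ^ (2 - α * (r - 1) - (2 - r)) ≤ x ^ (-(1 / 2) : ℝ) * y ^ r * x ^ (-(1 / 2) : ℝ) := by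
    rw [hd]
    have h1 := strictGeomMean_mono (α := 2 - r) ⟨by linarith [hr.2], by linarith [hr.1]⟩
      (hcp.cfc_rpow (-α)) (hcp.cfc_rpow (-1)) hx (hcp.cfc_rpow (-1)) hle le_rfl
    rw [strictGeomMean_rpow_rpow _ _ _ hcp] at h1
    have h2 := hcp.nonneg.isSelfAdjoint.conjugate_le_conjugate h1
    refine le_trans (le_of_eq ?_) h2
    calc _ = c ^ (1 : ℝ) * c ^ ((1 - (2 - r)) * -α + (2 - r) * -1) * c ^ (1 : ℝ) := by
          rw [hcadd, hcadd]; congr 1; ring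
      _ = _ := by rw [hc1]
  have hxge : c ^ (-α * (r - 1)) ≤ x ^ (r - 1) := by
    by_cases h0 : α = 0
    · subst h0
      have := CFC.rpow_le_rpow (p := r - 1) ⟨by linarith [hr.1], by linarith [hr.2]⟩ hle
      simpa [CFC.rpow_zero c hcp.nonneg] using this
    · rw [← CFC.rpow_rpow c _ _ (neg_ne_zero.2 h0) hcp]
      exact CFC.rpow_le_rpow ⟨by linarith [hr.1], by linarith [hr.2]⟩ hle
  have hmean := strictGeomMean_mono hα (hcp.cfc_rpow _) (hcp.cfc_rpow _) (hx.cfc_rpow _)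
    ((hy.cfc_rpow r).conjugate hsps') hxge hdge
  rw [strictGeomMean_rpow_rpow _ _ _ hcp] at hmean
  -- The exponents recombine to exactly `α`, so conjugating by `x ^ (1/2)` gives back `x #_α y`: in
  -- this range `x ^ r #_α y ^ r` dominates `x #_α y`, which is at least 1.
  rw [show (1 - α) * (-α * (r - 1)) + α * (2 - α * (r - 1) - (2 - r)) = α by ring] at hmean
  refine h.trans ?_
  have h2 := hsps.nonneg.isSelfAdjoint.conjugate_le_conjugate hmean
  have e : strictGeomMean α (x ^ r) (y ^ r) = x ^ (1 / 2 : ℝ) * strictGeomMean α (x ^ (r - 1))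
      (x ^ (-(1 / 2) : ℝ) * y ^ r * x ^ (-(1 / 2) : ℝ)) * x ^ (1 / 2 : ℝ) := by
    have hxr (q : ℝ) : (x ^ r) ^ q = x ^ (r * q) := CFC.rpow_rpow x _ _ (by linarith [hr.1]) hx
    have hxr' (q : ℝ) : (x ^ (r - 1)) ^ q = x ^ ((r - 1) * q) := by
      rcases eq_or_ne (r - 1) 0 with h0 | h0
      · simp [h0, CFC.rpow_zero x hx.nonneg]
      · exact CFC.rpow_rpow x _ _ h0 hx
    unfold strictGeomMean
    simp only [hxr, hxr']
    have e3 : x ^ ((r - 1) * -(1 / 2)) * (x ^ (-(1 / 2) : ℝ) * y ^ r * x ^ (-(1 / 2) : ℝ)) * x ^ ((r - 1) * -(1 / 2))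
        = x ^ (r * -(1 / 2)) * y ^ r * x ^ (r * -(1 / 2)) := by
      calc _ = (x ^ ((r - 1) * -(1 / 2)) * x ^ (-(1 / 2) : ℝ)) * y ^ r * (x ^ (-(1 / 2) : ℝ) * x ^ ((r - 1) * -(1 / 2))) := by
            noncomm_ring
        _ = _ := by rw [hadd, hadd]; congr 2 <;> ring_nf
    rw [e3]
    symm
    calc _ = (x ^ (1 / 2 : ℝ) * x ^ ((r - 1) * (1 / 2))) * (x ^ (r * -(1 / 2)) * y ^ r * x ^ (r * -(1 / 2))) ^ α *
          (x ^ ((r - 1) * (1 / 2)) * x ^ (1 / 2 : ℝ)) := by noncomm_ring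
      _ = _ := by rw [hadd, hadd]; congr 2 <;> ring_nf
  rw [e]
  refine le_trans (le_of_eq ?_) h2
  rw [hc]; rfl

/-- **Ando-Hiai inequality**: if `1 ≤ x #_α y` then `1 ≤ x^r #_α y^r` for all `r ≥ 1`. -/
theorem one_le_strictGeomMean_rpow {α : ℝ} (hα : α ∈ Set.Icc (0 : ℝ) 1) {x y : A}
    (hx : IsStrictlyPositive x) (hy : IsStrictlyPositive y) (h : 1 ≤ strictGeomMean α x y)
    {r : ℝ} (hr : 1 ≤ r) : 1 ≤ strictGeomMean α (x ^ r) (y ^ r) := by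
  obtain ⟨k, hk⟩ := pow_unbounded_of_one_lt r (one_lt_two)
  -- Squaring both elements preserves the hypothesis and halves the remaining exponent, so finitely
  -- many squarings bring it into `[1, 2]`.
  induction k generalizing r x y with
  | zero => exfalso; norm_num at hk; linarith
  | succ k ih =>
    rcases le_or_gt r 2 with h2 | h2
    · exact one_le_strictGeomMean_rpow_of_le_two hα hx hy h ⟨hr, h2⟩
    · have := ih (hx.cfc_rpow 2) (hy.cfc_rpow 2)
        (one_le_strictGeomMean_rpow_of_le_two hα hx hy h ⟨one_le_two, le_rfl⟩)
        (r := r / 2) (by linarith) (by rw [pow_succ] at hk; linarith)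
      rw [CFC.rpow_rpow x _ _ two_ne_zero hx, CFC.rpow_rpow y _ _ two_ne_zero hy] at this
      rwa [mul_div_cancel₀ r two_ne_zero] at this

end StrictGeomMean

/-! ### Compound matrices and the Cauchy-Binet formula -/

section Compound
variable {R : Type*} [CommRing R] {l k : ℕ}

/-- Order embeddings `Fin k ↪o Fin l` together with permutations of `Fin k` parametrise the
injections `Fin k → Fin l`. -/
theorem Fin.bijective_orderEmbedding_comp_perm (k l : ℕ) :
    Function.Bijective (fun x : (Fin k ↪o Fin l) × Equiv.Perm (Fin k) =>
      (⟨x.1 ∘ x.2, x.1.injective.comp x.2.injective⟩ :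
        {p : Fin k → Fin l // Function.Injective p})) := by
  constructor
  · rintro ⟨f, σ⟩ ⟨g, τ⟩ h
    have h' : f ∘ σ = g ∘ τ := congrArg Subtype.val h
    have hr : Set.range f = Set.range g := by
      rw [← σ.surjective.range_comp f, ← τ.surjective.range_comp g, h']
    obtain rfl := OrderEmbedding.range_inj.1 hr
    simp only [Prod.mk.injEq, true_and]
    exact Equiv.ext fun i => f.injective (congrFun h' i)
  · rintro ⟨p, hp⟩
    have hc : (Finset.univ.image p).card = k := by
      rw [Finset.card_image_of_injective _ hp, Finset.card_univ, Fintype.card_fin]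
    let e := (Finset.univ.image p).orderIsoOfFin hc
    -- `q i` is the rank of `p i` within the image of `p`, so `p` is the increasing enumeration of
    -- its image composed with `q`.
    let q : Fin k → Fin k := fun i => e.symm ⟨p i, Finset.mem_image_of_mem p (Finset.mem_univ i)⟩
    have hq : Function.Injective q := fun i j hij => hp (by simpa [q] using hij)
    refine ⟨((Finset.univ.image p).orderEmbOfFin hc,
      Equiv.ofBijective q (Finite.injective_iff_bijective.1 hq)), Subtype.ext (funext fun i => ?_)⟩
    change ((Finset.univ.image p).orderEmbOfFin hc) (q i) = p i
    rw [← Finset.coe_orderIsoOfFin_apply]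
    simp [q, e]

/-- The **Cauchy-Binet formula**. -/
theorem Matrix.det_mul_eq_sum_minors (M : Matrix (Fin k) (Fin l) R) (N : Matrix (Fin l) (Fin k) R) :
    (M * N).det =
      ∑ g : Fin k ↪o Fin l, (M.submatrix id g).det * (N.submatrix g id).det := by
  classical
  -- Each row of `M * N` is a combination of rows of `N`; expand the determinant multilinearly.
  -- Non-injective choices of rows then repeat a row and vanish.
  have h1 : (M * N).det = ∑ p : Fin k → Fin l, (∏ i, M i (p i)) * (N.submatrix p id).det := by
    have e : M * N = fun i => ∑ j, M i j • N j := by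
      ext i j; simp [Matrix.mul_apply, Finset.sum_apply]
    rw [e]
    change Matrix.detRowAlternating.toMultilinearMap _ = _
    rw [MultilinearMap.map_sum]
    refine Finset.sum_congr rfl fun p _ => ?_
    rw [MultilinearMap.map_smul_univ]
    rfl
  have h2 : ∑ p : Fin k → Fin l, (∏ i, M i (p i)) * (N.submatrix p id).det =
      ∑ p : {p : Fin k → Fin l // Function.Injective p},
        (∏ i, M i (p.1 i)) * (N.submatrix p.1 id).det := by
    rw [← Finset.sum_subtype (Finset.univ.filter fun p : Fin k → Fin l => Function.Injective p)
      (by simp) (fun p => (∏ i, M i (p i)) * (N.submatrix p id).det)]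
    refine (Finset.sum_subset (Finset.filter_subset _ _) fun p _ hp => ?_).symm
    rw [Finset.mem_filter_univ] at hp
    simp only [Function.Injective, not_forall] at hp
    obtain ⟨i, j, hij, hne⟩ := hp
    rw [Matrix.det_zero_of_row_eq hne (by ext; simp [hij]), mul_zero]
  rw [h1, h2, ← (Fin.bijective_orderEmbedding_comp_perm k l).sum_comp, Fintype.sum_prod_type]
  refine Finset.sum_congr rfl fun g _ => ?_
  rw [← Matrix.det_transpose (M.submatrix id g), Matrix.det_apply', Finset.sum_mul]
  refine Finset.sum_congr rfl fun σ _ => ?_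
  have : N.submatrix (g ∘ σ) id = (N.submatrix g id).submatrix σ id := rfl
  rw [this, Matrix.det_permute]
  simp only [Matrix.transpose_apply, Matrix.submatrix_apply, id, Function.comp]
  ring

/-- The `k`-th compound matrix: the matrix of all `k × k` minors. -/
def Matrix.compound (k : ℕ) (M : Matrix (Fin l) (Fin l) R) :
    Matrix (Fin k ↪o Fin l) (Fin k ↪o Fin l) R :=
  Matrix.of fun f g => (M.submatrix f g).det

theorem Matrix.compound_mul (M N : Matrix (Fin l) (Fin l) R) :
    (M * N).compound k = M.compound k * N.compound k := by
  ext f g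
  simp only [Matrix.compound, Matrix.of_apply, Matrix.mul_apply']
  have : (M * N).submatrix f g = M.submatrix f id * N.submatrix id g := by
    ext; simp [Matrix.mul_apply]
  rw [this, Matrix.det_mul_eq_sum_minors]
  rfl

theorem Matrix.compound_diagonal (d : Fin l → R) :
    (Matrix.diagonal d).compound k = Matrix.diagonal fun f : Fin k ↪o Fin l => ∏ i, d (f i) := by
  ext f g
  by_cases h : f = g
  · subst h
    simp only [Matrix.compound, Matrix.of_apply, Matrix.diagonal_apply_eq]
    rw [Matrix.submatrix_diagonal _ _ f.injective, Matrix.det_diagonal]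
    rfl
  · rw [Matrix.diagonal_apply_ne _ h]
    -- Two distinct index sets of equal size `k` are not nested, so this minor of the diagonal
    -- matrix has a zero row.
    have : ∃ i, f i ∉ Set.range g := by
      by_contra! hc
      refine h (OrderEmbedding.range_inj.1 ?_)
      have hsub : Finset.univ.image f ⊆ Finset.univ.image g := by
        intro x hx
        obtain ⟨i, -, rfl⟩ := Finset.mem_image.1 hx
        obtain ⟨j, hj⟩ := hc i
        exact Finset.mem_image.2 ⟨j, Finset.mem_univ _, hj⟩
      have := Finset.eq_of_subset_of_card_le hsub (by
        rw [Finset.card_image_of_injective _ g.injective, Finset.card_image_of_injective _ f.injective])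
      simpa using congrArg (fun s : Finset (Fin l) => (s : Set (Fin l))) this
    obtain ⟨i, hi⟩ := this
    refine Matrix.det_eq_zero_of_row_eq_zero i fun j => ?_
    exact Matrix.diagonal_apply_ne _ fun hj => hi ⟨j, hj.symm⟩

theorem Matrix.compound_one : (1 : Matrix (Fin l) (Fin l) R).compound k = 1 := by
  rw [← Matrix.diagonal_one, Matrix.compound_diagonal]
  simp

theorem Matrix.compound_star [StarRing R] (M : Matrix (Fin l) (Fin l) R) :
    (star M).compound k = star (M.compound k) := by
  ext f g
  simp only [Matrix.compound, Matrix.of_apply, Matrix.star_apply, Matrix.star_eq_conjTranspose]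
  rw [← Matrix.det_conjTranspose, Matrix.conjTranspose_submatrix]

theorem Matrix.compound_smul (c : R) (M : Matrix (Fin l) (Fin l) R) :
    (c • M).compound k = c ^ k • M.compound k := by
  ext f g
  simp [Matrix.compound, Matrix.submatrix_smul]

theorem Matrix.continuous_compound [TopologicalSpace R] [IsTopologicalRing R] :
    Continuous (Matrix.compound k : Matrix (Fin l) (Fin l) R → _) :=
  continuous_matrix fun f g => (continuous_id.matrix_submatrix f g).matrix_det

/-- The compound of a unitary matrix. -/
def Matrix.compoundUnitary (k : ℕ) (U : unitary (Matrix (Fin l) (Fin l) ℂ)) :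
    unitary (Matrix (Fin k ↪o Fin l) (Fin k ↪o Fin l) ℂ) :=
  ⟨(U : Matrix (Fin l) (Fin l) ℂ).compound k, by
    rw [Unitary.mem_iff, ← Matrix.compound_star, ← Matrix.compound_mul, ← Matrix.compound_mul,
      (Unitary.mem_iff.1 U.2).1, (Unitary.mem_iff.1 U.2).2, Matrix.compound_one]
    exact ⟨rfl, rfl⟩⟩

end Compound

/-! ### Unitarily diagonalised matrices: order and powers -/

section UnitaryDiagonal
variable {ι : Type*} [Fintype ι] [DecidableEq ι]

/-- The matrix `U diag(d) U*`. -/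
noncomputable def Matrix.unitaryDiagonal (U : unitary (Matrix ι ι ℂ)) (d : ι → ℝ) : Matrix ι ι ℂ :=
  (U : Matrix ι ι ℂ) * Matrix.diagonal (fun i => (d i : ℂ)) * star (U : Matrix ι ι ℂ)

theorem Matrix.IsHermitian.eq_unitaryDiagonal {A : Matrix ι ι ℂ} (hA : A.IsHermitian) :
    A = Matrix.unitaryDiagonal hA.eigenvectorUnitary hA.eigenvalues := by
  conv_lhs => rw [hA.spectral_theorem, Unitary.conjStarAlgAut_apply]
  rfl

theorem Matrix.PosSemidef.rpow_eq_unitaryDiagonal {A : Matrix ι ι ℂ} (hA : A.PosSemidef) (p : ℝ) :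
    A ^ p = Matrix.unitaryDiagonal hA.isHermitian.eigenvectorUnitary
      fun i => hA.isHermitian.eigenvalues i ^ p := by
  rw [CFC.rpow_eq_cfc_real (Matrix.nonneg_iff_posSemidef.2 hA), hA.isHermitian.cfc_eq,
    Matrix.IsHermitian.cfc, Unitary.conjStarAlgAut_apply]
  rfl

theorem Matrix.unitaryDiagonal_le_iff (U : unitary (Matrix ι ι ℂ)) (d e : ι → ℝ) :
    Matrix.unitaryDiagonal U d ≤ Matrix.unitaryDiagonal U e ↔ ∀ i, d i ≤ e i := by
  have key : Matrix.unitaryDiagonal U e - Matrix.unitaryDiagonal U d =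
      (U : Matrix ι ι ℂ) * Matrix.diagonal (fun i => ((e i - d i : ℝ) : ℂ)) * star (U : Matrix ι ι ℂ) := by
    rw [unitaryDiagonal, unitaryDiagonal, ← sub_mul, ← mul_sub, Matrix.diagonal_sub]
    simp
  rw [Matrix.le_iff, key, ← Matrix.nonneg_iff_posSemidef]
  have : (0 : Matrix ι ι ℂ) ≤ Matrix.diagonal (fun i => ((e i - d i : ℝ) : ℂ)) ↔ ∀ i, d i ≤ e i := by
    rw [Matrix.nonneg_iff_posSemidef, Matrix.posSemidef_diagonal_iff]
    simp
  rw [← this]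
  constructor
  · intro h
    have h1 := star_left_conjugate_nonneg h (U : Matrix ι ι ℂ)
    simpa [mul_assoc, ← mul_assoc (star (U : Matrix ι ι ℂ)) (U : Matrix ι ι ℂ)] using h1
  · intro h
    exact star_right_conjugate_nonneg h _

theorem Matrix.unitaryDiagonal_const (U : unitary (Matrix ι ι ℂ)) (c : ℝ) :
    Matrix.unitaryDiagonal U (fun _ => c) = c • (1 : Matrix ι ι ℂ) := by
  have : Matrix.diagonal (fun _ : ι => (c : ℂ)) = c • (1 : Matrix ι ι ℂ) := by
    ext i j; by_cases h : i = j <;> simp [Matrix.diagonal, h]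
  rw [unitaryDiagonal, this]; simp

theorem Matrix.smul_one_le_unitaryDiagonal_iff (U : unitary (Matrix ι ι ℂ)) (d : ι → ℝ) (c : ℝ) :
    c • (1 : Matrix ι ι ℂ) ≤ Matrix.unitaryDiagonal U d ↔ ∀ i, c ≤ d i := by
  rw [← Matrix.unitaryDiagonal_const U c, Matrix.unitaryDiagonal_le_iff]

theorem Matrix.unitaryDiagonal_le_one_iff (U : unitary (Matrix ι ι ℂ)) (d : ι → ℝ) :
    Matrix.unitaryDiagonal U d ≤ 1 ↔ ∀ i, d i ≤ 1 := by
  rw [← Matrix.unitaryDiagonal_le_iff U, Matrix.unitaryDiagonal_const, one_smul]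

theorem Matrix.unitaryDiagonal_nonneg_iff (U : unitary (Matrix ι ι ℂ)) (d : ι → ℝ) :
    0 ≤ Matrix.unitaryDiagonal U d ↔ ∀ i, 0 ≤ d i := by
  rw [← Matrix.smul_one_le_unitaryDiagonal_iff U, zero_smul]

/-- Real powers of a positive unitarily diagonalised matrix. -/
theorem Matrix.unitaryDiagonal_rpow (U : unitary (Matrix ι ι ℂ)) {d : ι → ℝ} (hd : ∀ i, 0 ≤ d i)
    (p : ℝ) : Matrix.unitaryDiagonal U d ^ p = Matrix.unitaryDiagonal U fun i => d i ^ p := by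
  have hpos : (Matrix.unitaryDiagonal U d).PosSemidef :=
    Matrix.nonneg_iff_posSemidef.1 ((Matrix.unitaryDiagonal_nonneg_iff U d).2 hd)
  obtain ⟨V, e, hA, hpow⟩ : ∃ (V : unitary (Matrix ι ι ℂ)) (e : ι → ℝ),
      Matrix.unitaryDiagonal U d = Matrix.unitaryDiagonal V e ∧
      Matrix.unitaryDiagonal U d ^ p = Matrix.unitaryDiagonal V fun i => e i ^ p :=
    ⟨_, _, hpos.isHermitian.eq_unitaryDiagonal, hpos.rpow_eq_unitaryDiagonal p⟩
  rw [hpow]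
  -- the unitary `W = U* V` intertwines the two diagonal matrices, hence also their powers
  obtain ⟨W, hW⟩ : ∃ W, W = star (U : Matrix ι ι ℂ) * V := ⟨_, rfl⟩
  have h1 : Matrix.diagonal (fun i => (d i : ℂ)) * W = W * Matrix.diagonal (fun i => (e i : ℂ)) := by
    unfold unitaryDiagonal at hA
    have h2 := congrArg (fun X => star (U : Matrix ι ι ℂ) * X * (V : Matrix ι ι ℂ)) hA
    simpa [mul_assoc, ← mul_assoc (star (U : Matrix ι ι ℂ)) (U : Matrix ι ι ℂ), hW] using h2
  have h3 : Matrix.diagonal (fun i => ((d i ^ p : ℝ) : ℂ)) * W =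
      W * Matrix.diagonal (fun i => ((e i ^ p : ℝ) : ℂ)) := by
    ext i j
    have h4 := congrFun (congrFun h1 i) j
    rw [Matrix.diagonal_mul, Matrix.mul_diagonal] at h4 ⊢
    rw [mul_comm] at h4 ⊢
    -- Entrywise the intertwining relation says `d i = e j` wherever `W i j ≠ 0`, so any function of
    -- the diagonals is intertwined too.
    by_cases h0 : W i j = 0
    · simp [h0]
    · have h5 := mul_left_cancel₀ h0 h4
      rw [Complex.ofReal_inj.1 h5]
  unfold unitaryDiagonal
  have hU : (U : Matrix ι ι ℂ) * W = V := by rw [hW, ← mul_assoc]; simp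
  have hV : W * star (V : Matrix ι ι ℂ) = star (U : Matrix ι ι ℂ) := by rw [hW, mul_assoc]; simp
  rw [← hU, mul_assoc (U : Matrix ι ι ℂ), ← h3, hU, mul_assoc, mul_assoc, hV, mul_assoc]

end UnitaryDiagonal

/-! ### Compounds of positive matrices: powers, means and order -/

section CompoundOrder
variable {l k : ℕ}

theorem Matrix.compound_unitaryDiagonal (U : unitary (Matrix (Fin l) (Fin l) ℂ)) (d : Fin l → ℝ) :
    (Matrix.unitaryDiagonal U d).compound k =
      Matrix.unitaryDiagonal (Matrix.compoundUnitary k U) fun f => ∏ i, d (f i) := by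
  unfold unitaryDiagonal
  rw [Matrix.compound_mul, Matrix.compound_mul, Matrix.compound_star, Matrix.compound_diagonal]
  simp [compoundUnitary]

/-- In an eigenbasis both sides are diagonal, and a product of powers of nonnegative eigenvalues is
the power of their product. -/
theorem Matrix.PosSemidef.compound_rpow {A : Matrix (Fin l) (Fin l) ℂ} (hA : A.PosSemidef) (p : ℝ) :
    (A ^ p).compound k = A.compound k ^ p := by
  rw [hA.rpow_eq_unitaryDiagonal, Matrix.compound_unitaryDiagonal]
  conv_rhs => rw [hA.isHermitian.eq_unitaryDiagonal, Matrix.compound_unitaryDiagonal]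
  rw [Matrix.unitaryDiagonal_rpow _ fun f => Finset.prod_nonneg fun i _ => hA.eigenvalues_nonneg _]
  congr 1
  ext f
  exact Real.finsetProd_rpow _ _ (fun i _ => hA.eigenvalues_nonneg _) p

theorem Matrix.PosSemidef.compound_nonneg {A : Matrix (Fin l) (Fin l) ℂ} (hA : A.PosSemidef) :
    0 ≤ A.compound k := by
  rw [hA.isHermitian.eq_unitaryDiagonal, Matrix.compound_unitaryDiagonal,
    Matrix.unitaryDiagonal_nonneg_iff]
  exact fun f => Finset.prod_nonneg fun i _ => hA.eigenvalues_nonneg _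

theorem IsStrictlyPositive.compound {A : Matrix (Fin l) (Fin l) ℂ} (hA : IsStrictlyPositive A) :
    IsStrictlyPositive (A.compound k) := by
  have hu : IsUnit (A.compound k) := by
    obtain ⟨B, hB⟩ := hA.isUnit.exists_right_inv
    refine IsUnit.of_mul_eq_one (B.compound k) ?_
    rw [← Matrix.compound_mul, hB, Matrix.compound_one]
  exact hu.isStrictlyPositive (Matrix.nonneg_iff_posSemidef.1 hA.nonneg).compound_nonneg

theorem compound_strictGeomMean (α : ℝ) {A B : Matrix (Fin l) (Fin l) ℂ}
    (hA : IsStrictlyPositive A) (hB : IsStrictlyPositive B) :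
    (strictGeomMean α A B).compound k = strictGeomMean α (A.compound k) (B.compound k) := by
  have hA' := Matrix.nonneg_iff_posSemidef.1 hA.nonneg
  have hC := Matrix.nonneg_iff_posSemidef.1 (hB.conjugate (hA.cfc_rpow (-(1 / 2)))).nonneg
  unfold strictGeomMean
  simp only [Matrix.compound_mul, hA'.compound_rpow, hC.compound_rpow]

/-- Congruence by `K ^ (-1/2)` reduces to `K = 1`. There the eigenvalues of the smaller matrix lie
in `[0, 1]`, hence so do their products; multiplicativity undoes the congruence. -/
theorem Matrix.compound_mono {H K : Matrix (Fin l) (Fin l) ℂ} (hH : 0 ≤ H)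
    (hK : IsStrictlyPositive K) (h : H ≤ K) : H.compound k ≤ K.compound k := by
  have hs := (hK.cfc_rpow (-(1 / 2))).nonneg.isSelfAdjoint
  have ht := (hK.cfc_rpow (1 / 2)).nonneg.isSelfAdjoint
  have hts : K ^ (1 / 2 : ℝ) * K ^ (-(1 / 2) : ℝ) = 1 := CFC.rpow_mul_rpow_neg _ hK
  have hst : K ^ (-(1 / 2) : ℝ) * K ^ (1 / 2 : ℝ) = 1 := CFC.rpow_neg_mul_rpow _ hK
  have htt : K ^ (1 / 2 : ℝ) * K ^ (1 / 2 : ℝ) = K := by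
    rw [← CFC.rpow_add hK.isUnit, add_halves, CFC.rpow_one K hK.nonneg]
  set s := K ^ (-(1 / 2) : ℝ)
  set t := K ^ (1 / 2 : ℝ)
  have h1 : s * H * s ≤ 1 := by
    refine (hs.conjugate_le_conjugate h).trans_eq ?_
    rw [← htt, ← mul_assoc, hst, one_mul, hts]
  have h0 : (s * H * s).PosSemidef := Matrix.nonneg_iff_posSemidef.1 (hs.conjugate_nonneg hH)
  have hc : (s * H * s).compound k ≤ 1 := by
    rw [h0.isHermitian.eq_unitaryDiagonal, Matrix.unitaryDiagonal_le_one_iff] at h1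
    rw [h0.isHermitian.eq_unitaryDiagonal, Matrix.compound_unitaryDiagonal,
      Matrix.unitaryDiagonal_le_one_iff]
    exact fun f => Finset.prod_le_one (fun i _ => h0.eigenvalues_nonneg _) fun i _ => h1 _
  have hct : IsSelfAdjoint (t.compound k) := by
    rw [IsSelfAdjoint, ← Matrix.compound_star, ht.star_eq]
  have h2 := hct.conjugate_le_conjugate hc
  rw [← Matrix.compound_mul, ← Matrix.compound_mul, mul_one, ← Matrix.compound_mul, htt] at h2
  convert h2 using 2
  calc H = (t * s) * H * (s * t) := by rw [hts, hst]; simp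
    _ = _ := by noncomm_ring

/-! ### Products of the smallest eigenvalues -/

theorem card_filter_sub_le {N k : ℕ} (hk : k ≤ N) :
    (Finset.univ.filter fun i : Fin N => N - k ≤ (i : ℕ)).card = k := by
  have := Finset.card_filter_add_card_filter_not (s := Finset.univ) (fun i : Fin N => (i : ℕ) < N - k)
  simp only [not_lt, Finset.card_univ, Fintype.card_fin, Fin.card_filter_val_lt] at this
  omega

/-- For a decreasing non-negative vector the last `k` entries have the least product. -/
theorem Antitone.prod_last_le_prod {N k : ℕ} (hk1 : 1 ≤ k) (hk : k ≤ N) {v : Fin N → ℝ}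
    (hv : Antitone v) (h0 : ∀ i, 0 ≤ v i) (S : Finset (Fin N)) (hS : S.card = k) :
    ∏ i ∈ Finset.univ.filter (fun i : Fin N => N - k ≤ (i : ℕ)), v i ≤ ∏ i ∈ S, v i := by
  set L := Finset.univ.filter (fun i : Fin N => N - k ≤ (i : ℕ)) with hL
  have hLc : L.card = k := card_filter_sub_le hk
  -- The first index of the tail, which exists because `k ≥ 1`: `v j` bounds the entries in the tail
  -- from above and those outside it from below.
  let j : Fin N := ⟨N - k, by omega⟩
  have hcard : (L \ S).card = (S \ L).card :=
    Finset.card_sdiff_comm (hLc.trans hS.symm)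
  rw [← Finset.prod_inter_mul_prod_sdiff L S, ← Finset.prod_inter_mul_prod_sdiff S L,
    Finset.inter_comm S L]
  refine mul_le_mul_of_nonneg_left ?_ (Finset.prod_nonneg fun i _ => h0 i)
  calc ∏ i ∈ L \ S, v i ≤ ∏ _i ∈ L \ S, v j := by
        refine Finset.prod_le_prod (fun i _ => h0 i) fun i hi => hv ?_
        have := (Finset.mem_sdiff.1 hi).1
        rw [hL, Finset.mem_filter] at this
        exact Fin.mk_le_of_le_val this.2
    _ = ∏ _i ∈ S \ L, v j := by rw [Finset.prod_const, Finset.prod_const, hcard]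
    _ ≤ ∏ i ∈ S \ L, v i := by
        refine Finset.prod_le_prod (fun i _ => h0 _) fun i hi => hv ?_
        have := (Finset.mem_sdiff.1 hi).2
        rw [hL, Finset.mem_filter] at this
        simp only [Finset.mem_univ, true_and, not_le] at this
        exact Fin.le_def.2 this.le

/-- The compound of a positive semidefinite matrix is bounded below by the product of the smallest
`k` eigenvalues, and this bound is optimal. -/
theorem Matrix.PosSemidef.smul_one_le_compound_iff {H : Matrix (Fin l) (Fin l) ℂ}
    (hH : H.PosSemidef) (hk1 : 1 ≤ k) (hk : k ≤ Fintype.card (Fin l)) (c : ℝ) :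
    c • (1 : Matrix (Fin k ↪o Fin l) (Fin k ↪o Fin l) ℂ) ≤ H.compound k ↔
      c ≤ ∏ i ∈ Finset.univ.filter (fun i : Fin (Fintype.card (Fin l)) =>
        Fintype.card (Fin l) - k ≤ (i : ℕ)), eigenvaluesDesc H i := by
  rw [eigenvaluesDesc_eq hH.isHermitian]
  conv_lhs => rw [hH.isHermitian.eq_unitaryDiagonal, Matrix.compound_unitaryDiagonal,
    Matrix.smul_one_le_unitaryDiagonal_iff]
  -- This is the reindexing by which `eigenvalues` is defined from `eigenvalues₀`, so `he` holds by
  -- `rfl`.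
  let e : Fin l ≃ Fin (Fintype.card (Fin l)) :=
    (Fintype.equivOfCardEq (Fintype.card_fin _) : Fin (Fintype.card (Fin l)) ≃ Fin l).symm
  have he : ∀ i, hH.isHermitian.eigenvalues i = hH.isHermitian.eigenvalues₀ (e i) := fun i => rfl
  have h0 : ∀ i, 0 ≤ hH.isHermitian.eigenvalues₀ i := fun i => by
    have := hH.eigenvalues_nonneg (e.symm i)
    rwa [he, Equiv.apply_symm_apply] at this
  simp only [he]
  constructor
  · intro h
    set L := Finset.univ.filter (fun i : Fin (Fintype.card (Fin l)) =>
      Fintype.card (Fin l) - k ≤ (i : ℕ))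
    have hc : (L.map e.symm.toEmbedding).card = k := by
      rw [Finset.card_map]; exact card_filter_sub_le hk
    -- Test the bound at the diagonal entry indexed by the positions of the `k` smallest
    -- eigenvalues.
    have := h ((L.map e.symm.toEmbedding).orderEmbOfFin hc)
    refine this.trans_eq ?_
    refine (Finset.prod_map Finset.univ ((L.map e.symm.toEmbedding).orderEmbOfFin hc).toEmbedding
      fun i => hH.isHermitian.eigenvalues₀ (e i)).symm.trans ?_
    rw [Finset.map_orderEmbOfFin_univ, Finset.prod_map]
    simp
  · intro h f
    refine h.trans ((hH.isHermitian.eigenvalues₀_antitone.prod_last_le_prod hk1 hk h0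
      (Finset.univ.map (f.toEmbedding.trans e.toEmbedding)) (by simp)).trans_eq ?_)
    exact Finset.prod_map _ _ _

end CompoundOrder

/-! ### Operator Jensen inequality for powers in (0, 1] -/

section Jensen

/-- Operator convexity of the inverse, for a positive resolution `C` of the identity. -/
theorem inverse_sum_smul_le {A : Type*} [CStarAlgebra A] [PartialOrder A] [StarOrderedRing A]
    {ι : Type*} [Fintype ι] {C : ι → A} (hC : ∀ i, 0 ≤ C i) (h1 : ∑ i, C i = 1) {s : ι → ℝ}
    (hs : ∀ i, 0 < s i) {R : A} (hR : IsSelfAdjoint R) (hRS : R * ∑ i, s i • C i = 1) :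
    R ≤ ∑ i, (s i)⁻¹ • C i := by
  -- Completing the square: with `S = ∑ s i • C i` and `R S = 1`, expanding gives `∑ (s i)⁻¹ • C i -
  -- 2 R + R S R`, and `R S R = R`.
  have h : 0 ≤ ∑ i, s i • (((s i)⁻¹ • (1 : A) - R) * C i * ((s i)⁻¹ • (1 : A) - R)) := by
    refine Finset.sum_nonneg fun i _ => smul_nonneg (hs i).le ?_
    exact (((IsSelfAdjoint.all (s i)⁻¹).smul (.one A)).sub hR).conjugate_nonneg (hC i)
  have e : ∑ i, s i • (((s i)⁻¹ • (1 : A) - R) * C i * ((s i)⁻¹ • (1 : A) - R)) =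
      ∑ i, (s i)⁻¹ • C i - R := by
    have e1 : ∀ i, s i • (((s i)⁻¹ • (1 : A) - R) * C i * ((s i)⁻¹ • (1 : A) - R)) =
        (s i)⁻¹ • C i - C i * R - R * C i + R * (s i • C i) * R := by
      intro i
      have := (hs i).ne'
      simp only [sub_mul, mul_sub, smul_mul_assoc, mul_smul_comm, one_mul, mul_one, smul_sub, smul_smul]
      field_simp
      simp only [one_smul, mul_assoc]
      abel
    simp only [e1, Finset.sum_add_distrib, Finset.sum_sub_distrib, ← Finset.mul_sum, ← Finset.sum_mul]
    rw [h1, hRS]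
    simp
  rw [e] at h
  exact sub_nonneg.1 h

variable {κ : Type*} [Fintype κ] [DecidableEq κ]

theorem Matrix.unitaryDiagonal_sub (U : unitary (Matrix κ κ ℂ)) (d e : κ → ℝ) :
    Matrix.unitaryDiagonal U (d - e) = Matrix.unitaryDiagonal U d - Matrix.unitaryDiagonal U e := by
  rw [unitaryDiagonal, unitaryDiagonal, unitaryDiagonal, ← sub_mul, ← mul_sub, Matrix.diagonal_sub]
  simp

theorem Matrix.unitaryDiagonal_smul (U : unitary (Matrix κ κ ℂ)) (c : ℝ) (d : κ → ℝ) :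
    Matrix.unitaryDiagonal U (c • d) = c • Matrix.unitaryDiagonal U d := by
  rw [unitaryDiagonal, unitaryDiagonal, ← smul_mul_assoc, ← mul_smul_comm]
  congr 2
  ext i j
  by_cases h : i = j <;> simp [Matrix.diagonal, h]

theorem Matrix.unitaryDiagonal_mul (U : unitary (Matrix κ κ ℂ)) (d e : κ → ℝ) :
    Matrix.unitaryDiagonal U d * Matrix.unitaryDiagonal U e = Matrix.unitaryDiagonal U (d * e) := by
  have hU : star (U : Matrix κ κ ℂ) * U = 1 := (Unitary.mem_iff.1 U.2).1
  have hd : Matrix.diagonal (fun i => ((d * e) i : ℂ)) =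
      Matrix.diagonal (fun i => (d i : ℂ)) * Matrix.diagonal (fun i => (e i : ℂ)) := by
    simp [Matrix.diagonal_mul_diagonal]
  unfold unitaryDiagonal
  rw [hd]
  calc _ = (U : Matrix κ κ ℂ) * Matrix.diagonal (fun i => (d i : ℂ)) *
          (star (U : Matrix κ κ ℂ) * U) * Matrix.diagonal (fun i => (e i : ℂ)) *
          star (U : Matrix κ κ ℂ) := by noncomm_ring
    _ = _ := by rw [hU]; noncomm_ring

theorem Matrix.unitaryDiagonal_eq_sum (U : unitary (Matrix κ κ ℂ)) (d : κ → ℝ) :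
    Matrix.unitaryDiagonal U d = ∑ i, d i • Matrix.unitaryDiagonal U (Pi.single i 1) := by
  simp only [← Matrix.unitaryDiagonal_smul]
  unfold unitaryDiagonal
  rw [← Finset.sum_mul, ← Finset.mul_sum]
  congr 2
  ext i j
  rw [Matrix.sum_apply]
  by_cases h : i = j
  · subst h
    simp only [Matrix.diagonal_apply_eq]
    rw [Finset.sum_eq_single i (fun j _ hj => by simp [hj.symm]) (by simp)]
    simp
  · simp [h]

/-- Operator Jensen inequality for the integrand of the integral representation of `x ↦ x ^ p`. -/
theorem sum_rpowIntegrand_smul_le {ι : Type*} [Fintype ι] {C : ι → Matrix κ κ ℂ}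
    (hC : ∀ i, 0 ≤ C i) (h1 : ∑ i, C i ≤ 1) {a : ι → ℝ} (ha : ∀ i, 0 ≤ a i)
    {V : unitary (Matrix κ κ ℂ)} {b : κ → ℝ} (hb : ∀ i, 0 ≤ b i)
    (hT : ∑ i, a i • C i = Matrix.unitaryDiagonal V b) {p t : ℝ} (ht : 0 < t) :
    ∑ i, Real.rpowIntegrand₀₁ p t (a i) • C i ≤
      Matrix.unitaryDiagonal V fun j => Real.rpowIntegrand₀₁ p t (b j) := by
  set R := Matrix.unitaryDiagonal V fun j => (t + b j)⁻¹ with hR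
  have hR0 : 0 ≤ R := (Matrix.unitaryDiagonal_nonneg_iff V _).2 fun j =>
    inv_nonneg.2 (add_nonneg ht.le (hb j))
  -- The missing mass `1 - ∑ C i` is placed at the node 0, where the integrand vanishes; this turns
  -- a subresolution of the identity into a resolution.
  let C' : Option ι → Matrix κ κ ℂ := fun o => o.elim (1 - ∑ i, C i) C
  let s : Option ι → ℝ := fun o => o.elim t fun i => t + a i
  have hS : ∑ o, s o • C' o = Matrix.unitaryDiagonal V fun j => t + b j := by
    have : (Matrix.unitaryDiagonal V fun j => t + b j) = t • 1 + Matrix.unitaryDiagonal V b := by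
      rw [← Matrix.unitaryDiagonal_const V t, ← sub_eq_iff_eq_add, ← Matrix.unitaryDiagonal_sub]
      congr 1; ext j; simp
    rw [Fintype.sum_option, this, ← hT]
    simp only [s, C', Option.elim, add_smul, Finset.sum_add_distrib, ← Finset.smul_sum, smul_sub]
    abel
  have key := inverse_sum_smul_le (C := C') (s := s) (R := R)
    (by rintro (_ | i); exacts [sub_nonneg.2 h1, hC i])
    (by rw [Fintype.sum_option]; simp [C'])
    (by rintro (_ | i); exacts [ht, by simp only [s, Option.elim]; linarith [ha i]])
    hR0.isSelfAdjoint
    (by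
      rw [hS, hR, Matrix.unitaryDiagonal_mul, ← one_smul ℝ (1 : Matrix κ κ ℂ),
        ← Matrix.unitaryDiagonal_const V]
      congr 1; ext j
      exact inv_mul_cancel₀ (by linarith [hb j]))
  rw [Fintype.sum_option] at key
  simp only [s, C', Option.elim] at key
  have eR : (Matrix.unitaryDiagonal V fun j => Real.rpowIntegrand₀₁ p t (b j)) =
      t ^ p • (t⁻¹ • 1 - R) := by
    rw [hR, ← Matrix.unitaryDiagonal_const V t⁻¹, ← Matrix.unitaryDiagonal_sub,
      ← Matrix.unitaryDiagonal_smul]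
    rfl
  have eL : ∑ i, Real.rpowIntegrand₀₁ p t (a i) • C i =
      t ^ p • (t⁻¹ • 1 - (t⁻¹ • (1 - ∑ i, C i) + ∑ i, (t + a i)⁻¹ • C i)) := by
    simp only [Real.rpowIntegrand₀₁, mul_smul, sub_smul, ← Finset.smul_sum, Finset.sum_sub_distrib]
    congr 1
    rw [smul_sub]
    abel
  rw [eR, eL]
  exact smul_le_smul_of_nonneg_left (sub_le_sub_left key _) (by positivity)

theorem sum_smul_eq_integral {Ω E ι : Type*} [MeasurableSpace Ω] [NormedAddCommGroup E]
    [NormedSpace ℝ E] [CompleteSpace E] [Fintype ι] {μ : MeasureTheory.Measure Ω} {x : ι → ℝ}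
    {f : ι → Ω → ℝ} (h : ∀ i, MeasureTheory.Integrable (f i) μ ∧ x i = ∫ t, f i t ∂μ) (D : ι → E) :
    MeasureTheory.Integrable (fun t => ∑ i, f i t • D i) μ ∧
      ∑ i, x i • D i = ∫ t, ∑ i, f i t • D i ∂μ := by
  have hint : ∀ i, MeasureTheory.Integrable (fun t => f i t • D i) μ :=
    fun i => (h i).1.smul_const (D i)
  refine ⟨MeasureTheory.integrable_finsetSum _ fun i _ => hint i, ?_⟩
  rw [MeasureTheory.integral_finsetSum _ fun i _ => hint i]
  exact Finset.sum_congr rfl fun i _ => by rw [integral_smul_const, ← (h i).2]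

/-- Operator Jensen inequality for `x ↦ x ^ p`, `0 < p ≤ 1`. -/
theorem sum_rpow_smul_le {ι : Type*} [Fintype ι] {C : ι → Matrix κ κ ℂ}
    (hC : ∀ i, 0 ≤ C i) (h1 : ∑ i, C i ≤ 1) {a : ι → ℝ} (ha : ∀ i, 0 ≤ a i)
    {p : ℝ} (hp0 : 0 < p) (hp1 : p ≤ 1) :
    ∑ i, a i ^ p • C i ≤ (∑ i, a i • C i) ^ p := by
  have hT0 : 0 ≤ ∑ i, a i • C i := Finset.sum_nonneg fun i _ => smul_nonneg (ha i) (hC i)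
  -- The integral representation used below requires `p < 1`.
  rcases hp1.eq_or_lt with rfl | hp1
  · simp [CFC.rpow_one _ hT0]
  have hT := Matrix.nonneg_iff_posSemidef.1 hT0
  rw [hT.rpow_eq_unitaryDiagonal]
  set V := hT.isHermitian.eigenvectorUnitary
  set b := hT.isHermitian.eigenvalues with hb
  have hb0 : ∀ j, 0 ≤ b j := hT.eigenvalues_nonneg
  obtain ⟨μ, hμ⟩ := Real.exists_measure_rpow_eq_integral_rpowIntegrand₀₁ (p := p) ⟨hp0, hp1⟩
  obtain ⟨hi, he⟩ := sum_smul_eq_integral (fun i => hμ (a i) (ha i)) C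
  -- With the spectral projections of `∑ a i • C i` as coefficients, the same formula represents its
  -- `p`-th power as an integral.
  obtain ⟨hi', he'⟩ := sum_smul_eq_integral (fun j => hμ (b j) (hb0 j))
    fun j => Matrix.unitaryDiagonal V (Pi.single j 1)
  rw [Matrix.unitaryDiagonal_eq_sum V, he, he']
  refine MeasureTheory.integral_mono_ae hi hi' ?_
  filter_upwards [MeasureTheory.ae_restrict_mem measurableSet_Ioi] with t ht
  rw [← Matrix.unitaryDiagonal_eq_sum V fun j => Real.rpowIntegrand₀₁ p t (b j)]
  exact sum_rpowIntegrand_smul_le hC h1 ha hb0 hT.isHermitian.eq_unitaryDiagonal ht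

/-- Jensen's inequality for powers under a positive linear map. -/
theorem PositiveLinearMap.apply_rpow_le {ι : Type*} [Fintype ι] [DecidableEq ι]
    (Φ : Matrix ι ι ℂ →ₚ[ℂ] Matrix κ κ ℂ) {c : ℝ} (hc : 0 < c)
    (hΦ : Φ 1 ≤ c • (1 : Matrix κ κ ℂ)) {A : Matrix ι ι ℂ} (hA : A.PosSemidef) {p : ℝ}
    (hp0 : 0 < p) (hp1 : p ≤ 1) : c⁻¹ • Φ (A ^ p) ≤ (c⁻¹ • Φ A) ^ p := by
  set U := hA.isHermitian.eigenvectorUnitary with hU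
  set a := hA.isHermitian.eigenvalues with ha
  have hsmul (x : ℝ) (X : Matrix ι ι ℂ) : Φ (x • X) = x • Φ X := by
    rw [← Complex.coe_smul, map_smul, Complex.coe_smul]
  -- Only the images of the spectral projections of `A` matter: scaled by `c⁻¹` they are positive
  -- with sum at most 1, so the finite-sum Jensen inequality applies.
  have hΦU (d : ι → ℝ) : c⁻¹ • Φ (Matrix.unitaryDiagonal U d) =
      ∑ i, d i • (c⁻¹ • Φ (Matrix.unitaryDiagonal U (Pi.single i 1))) := by
    rw [Matrix.unitaryDiagonal_eq_sum, map_sum, Finset.smul_sum]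
    exact Finset.sum_congr rfl fun i _ => by rw [hsmul, smul_comm]
  have h1 : ∑ i, c⁻¹ • Φ (Matrix.unitaryDiagonal U (Pi.single i 1)) ≤ 1 := by
    have := hΦU fun _ => 1
    rw [Matrix.unitaryDiagonal_const, one_smul] at this
    simp only [one_smul] at this
    rw [← this]
    refine (smul_le_smul_of_nonneg_left hΦ (inv_nonneg.2 hc.le)).trans_eq ?_
    rw [smul_smul, inv_mul_cancel₀ hc.ne', one_smul]
  have h0 : ∀ i, 0 ≤ c⁻¹ • Φ (Matrix.unitaryDiagonal U (Pi.single i 1)) := by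
    intro i
    refine smul_nonneg (inv_nonneg.2 hc.le) (Φ.map_nonneg ?_)
    rw [Matrix.unitaryDiagonal_nonneg_iff]
    intro j
    by_cases h : j = i <;> simp [h]
  rw [hA.rpow_eq_unitaryDiagonal, hΦU]
  conv_rhs => rw [hA.isHermitian.eq_unitaryDiagonal, hΦU]
  exact sum_rpow_smul_le h0 h1 hA.eigenvalues_nonneg hp0 hp1

end Jensen

/-! ### Limits, positive maps and the estimate for each k -/

section WeightedGeomMean

theorem scalarGeomMean_pos {α a b : ℝ} (ha : 0 < a) (hb : 0 < b) : 0 < scalarGeomMean α a b := by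
  unfold scalarGeomMean; positivity

theorem scalarGeomMean_self (α : ℝ) {a : ℝ} (ha : 0 < a) : scalarGeomMean α a a = a := by
  rw [scalarGeomMean, ← Real.rpow_add ha, sub_add_cancel, Real.rpow_one]

theorem scalarGeomMean_inv (α : ℝ) {a b : ℝ} (ha : 0 < a) (hb : 0 < b) :
    scalarGeomMean α a⁻¹ b⁻¹ = (scalarGeomMean α a b)⁻¹ := by
  rw [scalarGeomMean, scalarGeomMean, Real.inv_rpow ha.le, Real.inv_rpow hb.le, mul_inv]

/-- All exponents are nonnegative, so the real powers stay continuous even when a base tends to 0.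
-/
theorem tendsto_scalarGeomMean_add {α : ℝ} (hα : α ∈ Set.Icc (0 : ℝ) 1) (a b c : ℝ) (k : ℕ) {s : ℝ}
    (hs : 0 ≤ s) : Tendsto (fun δ : ℝ => (scalarGeomMean α (a + δ) (b + δ) ^ s) ^ k * c) (𝓝[>] 0)
      (𝓝 ((scalarGeomMean α a b ^ s) ^ k * c)) := by
  have h1 : ContinuousAt (fun δ : ℝ => (a + δ) ^ (1 - α)) 0 :=
    (continuousAt_const.add continuousAt_id).rpow_const (Or.inr (by linarith [hα.2]))
  have h2 : ContinuousAt (fun δ : ℝ => (b + δ) ^ α) 0 :=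
    (continuousAt_const.add continuousAt_id).rpow_const (Or.inr hα.1)
  have h := ((((h1.mul h2).rpow_const (p := s) (Or.inr hs)).pow k).mul
    (continuousAt_const (y := c))).tendsto
  simp only [add_zero, Pi.mul_apply, Pi.pow_apply] at h
  exact h.mono_left nhdsWithin_le_nhds

theorem Matrix.PosSemidef.isStrictlyPositive_add_smul_one {ι : Type*} [Fintype ι] [DecidableEq ι]
    {X : Matrix ι ι ℂ} (hX : X.PosSemidef) {ε : ℝ} (hε : 0 < ε) :
    IsStrictlyPositive (X + ε • 1) :=
  Matrix.isStrictlyPositive_iff_posDef.2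
    (Matrix.PosDef.posSemidef_add hX (Matrix.PosDef.one.smul hε))

theorem IsStrictlyPositive.exists_smul_one_le {ι : Type*} [Fintype ι] [DecidableEq ι]
    {X : Matrix ι ι ℂ} (hX : IsStrictlyPositive X) : ∃ η : ℝ, 0 < η ∧ η • 1 ≤ X := by
  have hpd := Matrix.isStrictlyPositive_iff_posDef.1 hX
  have hev := hpd.eigenvalues_pos
  obtain ⟨η, h0, h⟩ : ∃ η : ℝ, 0 < η ∧ ∀ i, η ≤ hpd.isHermitian.eigenvalues i := by
    rcases isEmpty_or_nonempty ι with h | h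
    · exact ⟨1, one_pos, fun i => h.elim i⟩
    · obtain ⟨i, hi⟩ := Finite.exists_min hpd.isHermitian.eigenvalues
      exact ⟨_, hev i, hi⟩
  refine ⟨η, h0, ?_⟩
  rw [hpd.isHermitian.eq_unitaryDiagonal, Matrix.smul_one_le_unitaryDiagonal_iff]
  exact h

/-- Monotonicity of the geometric mean, with a positive definite majorant. -/
theorem weightedGeomMean_le_strictGeomMean {ι : Type*} [Fintype ι] [DecidableEq ι] {α : ℝ}
    (hα : α ∈ Set.Icc (0 : ℝ) 1) {X Y X' Y' : Matrix ι ι ℂ} (hX : X.PosSemidef)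
    (hY : Y.PosSemidef) (hX' : IsStrictlyPositive X') (hY' : IsStrictlyPositive Y')
    (hXX' : X ≤ X') (hYY' : Y ≤ Y') : weightedGeomMean α X Y ≤ strictGeomMean α X' Y' := by
  obtain ⟨η₁, hη₁, hle₁⟩ := hX'.exists_smul_one_le
  obtain ⟨η₂, hη₂, hle₂⟩ := hY'.exists_smul_one_le
  obtain ⟨η, hη, h1, h2⟩ : ∃ η : ℝ, 0 < η ∧ η ≤ η₁ ∧ η ≤ η₂ :=
    ⟨min η₁ η₂, lt_min hη₁ hη₂, min_le_left _ _, min_le_right _ _⟩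
  -- Since `η • 1 ≤ Z'`, the shift by `δ` is absorbed into a factor `1 + δ / η`, which leaves the
  -- mean by homogeneity and tends to 1.
  have bound {Z Z' : Matrix ι ι ℂ} (hZ : Z ≤ Z') {ζ : ℝ} (hζ : η ≤ ζ) (hZ' : ζ • 1 ≤ Z') {δ : ℝ}
      (hδ : 0 < δ) : Z + δ • 1 ≤ (1 + δ / η) • Z' := by
    rw [add_smul, one_smul]
    refine add_le_add hZ ?_
    have h3 : η • (1 : Matrix ι ι ℂ) ≤ Z' :=
      (smul_le_smul_of_nonneg_right hζ zero_le_one).trans hZ'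
    have h4 := smul_le_smul_of_nonneg_left h3 (div_nonneg hδ.le hη.le)
    rwa [smul_smul, div_mul_cancel₀ _ hη.ne'] at h4
  have hlim : Tendsto (fun δ : ℝ => (1 + δ / η) • strictGeomMean α X' Y') (𝓝[>] 0)
      (𝓝 (strictGeomMean α X' Y')) := by
    have : Continuous fun δ : ℝ => (1 + δ / η) • strictGeomMean α X' Y' := by fun_prop
    have h := this.tendsto 0
    simp only [zero_div, add_zero, one_smul] at h
    exact h.mono_left nhdsWithin_le_nhds
  refine le_of_tendsto_of_tendsto (tendsto_weightedGeomMean hα hX hY) hlim ?_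
  filter_upwards [self_mem_nhdsWithin] with δ hδ
  have hδ' : (0 : ℝ) < δ := hδ
  have hpos : 0 < 1 + δ / η := by positivity
  have e := strictGeomMean_smul α hX' hY' hpos hpos
  rw [scalarGeomMean_self α hpos] at e
  rw [← e]
  exact strictGeomMean_mono hα (hX.isStrictlyPositive_add_smul_one hδ')
    (hY.isStrictlyPositive_add_smul_one hδ') (hX'.pos_smul hpos) (hY'.pos_smul hpos)
    (bound hXX' h1 hle₁ hδ') (bound hYY' h2 hle₂ hδ')

variable {l k : ℕ}

theorem Matrix.compound_real_smul (c : ℝ) (M : Matrix (Fin l) (Fin l) ℂ) :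
    (c • M).compound k = c ^ k • M.compound k := by
  rw [← Complex.coe_smul, Matrix.compound_smul, ← Complex.ofReal_pow, Complex.coe_smul]

/-- The Ando-Hiai inequality for compound matrices. -/
theorem rpow_smul_one_le_compound_strictGeomMean {α : ℝ} (hα : α ∈ Set.Icc (0 : ℝ) 1)
    {U V : Matrix (Fin l) (Fin l) ℂ} (hU : IsStrictlyPositive U) (hV : IsStrictlyPositive V)
    {m : ℝ} (hm : 0 < m) (h : m • 1 ≤ (strictGeomMean α U V).compound k) {r : ℝ} (hr : 1 ≤ r) :
    m ^ r • 1 ≤ (strictGeomMean α (U ^ r) (V ^ r)).compound k := by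
  have hm' : 0 < m⁻¹ := inv_pos.2 hm
  have hU' := hU.compound (k := k)
  have hV' := hV.compound (k := k)
  rw [compound_strictGeomMean α hU hV] at h
  have h1 : 1 ≤ strictGeomMean α (m⁻¹ • U.compound k) (m⁻¹ • V.compound k) := by
    rw [strictGeomMean_smul α hU' hV' hm' hm', scalarGeomMean_self α hm']
    have := smul_le_smul_of_nonneg_left h hm'.le
    rwa [smul_smul, inv_mul_cancel₀ hm.ne', one_smul] at this
  have h2 := one_le_strictGeomMean_rpow hα (hU'.pos_smul hm') (hV'.pos_smul hm') h1 hr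
  have hmr : 0 < m⁻¹ ^ r := by positivity
  rw [cfc_smul_rpow hU'.nonneg hm' hU'.isUnit, cfc_smul_rpow hV'.nonneg hm' hV'.isUnit,
    strictGeomMean_smul α (hU'.cfc_rpow r) (hV'.cfc_rpow r) hmr hmr, scalarGeomMean_self α hmr,
    ← (Matrix.nonneg_iff_posSemidef.1 hU.nonneg).compound_rpow,
    ← (Matrix.nonneg_iff_posSemidef.1 hV.nonneg).compound_rpow,
    ← compound_strictGeomMean α (hU.cfc_rpow r) (hV.cfc_rpow r)] at h2
  have h3 := smul_le_smul_of_nonneg_left h2 (show 0 ≤ m ^ r by positivity)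
  rwa [smul_smul, ← Real.mul_rpow hm.le hm'.le, mul_inv_cancel₀ hm.ne', Real.one_rpow,
    one_smul] at h3

theorem PositiveLinearMap.apply_posSemidef {ι κ : Type*} [Fintype ι] [Fintype κ]
    (Φ : Matrix ι ι ℂ →ₚ[ℂ] Matrix κ κ ℂ) {A : Matrix ι ι ℂ} (hA : A.PosSemidef) :
    (Φ A).PosSemidef :=
  Matrix.nonneg_iff_posSemidef.1 (Φ.map_nonneg (Matrix.nonneg_iff_posSemidef.2 hA))

theorem Matrix.PosSemidef.rpow {ι : Type*} [Fintype ι] [DecidableEq ι] (A : Matrix ι ι ℂ) (r : ℝ) :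
    (A ^ r).PosSemidef :=
  Matrix.nonneg_iff_posSemidef.1 CFC.rpow_nonneg

/-- Jensen with exponent `1/r`, evaluated at `A ^ r`. The added `ε` makes the base invertible, and
monotonicity of the power `1/r` accommodates it. -/
theorem PositiveLinearMap.apply_le_smul_rpow {ι κ : Type*} [Fintype ι] [DecidableEq ι] [Fintype κ]
    [DecidableEq κ] (Φ : Matrix ι ι ℂ →ₚ[ℂ] Matrix κ κ ℂ) {a : ℝ} (ha : 0 < a)
    (hΦ : Φ 1 ≤ a • (1 : Matrix κ κ ℂ)) {A : Matrix ι ι ℂ} (hA : A.PosSemidef) {r : ℝ}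
    (hr : 1 ≤ r) {ε : ℝ} (hε : 0 < ε) :
    Φ A ≤ a • (a⁻¹ • (Φ (A ^ r) + ε • 1)) ^ r⁻¹ := by
  have hr0 : 0 < r := by linarith
  have h1 := Φ.apply_rpow_le ha hΦ (Matrix.PosSemidef.rpow A r) (inv_pos.2 hr0)
    (inv_le_one_of_one_le₀ hr)
  rw [CFC.rpow_rpow_of_exponent_nonneg A r r⁻¹ hr0.le (inv_pos.2 hr0).le
    (Matrix.nonneg_iff_posSemidef.2 hA), mul_inv_cancel₀ hr0.ne',
    CFC.rpow_one A (Matrix.nonneg_iff_posSemidef.2 hA)] at h1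
  have h2 : a⁻¹ • Φ (A ^ r) ≤ a⁻¹ • (Φ (A ^ r) + ε • 1) :=
    smul_le_smul_of_nonneg_left
      (le_add_of_nonneg_right (smul_nonneg hε.le zero_le_one)) (inv_pos.2 ha).le
  have h3 := h1.trans (CFC.rpow_le_rpow (p := r⁻¹)
    ⟨(inv_pos.2 hr0).le, inv_le_one_of_one_le₀ hr⟩ h2)
  have h4 := smul_le_smul_of_nonneg_left h3 ha.le
  rwa [smul_smul, mul_inv_cancel₀ ha.ne', one_smul] at h4

/-- The core estimate, for strict constants `a`, `b` and `m > 0`: Jensen, monotonicity of means and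
compounds, then Ando-Hiai, with `ε → 0` at the end. -/
theorem rpow_smul_one_le_compound_weightedGeomMean {ι κ : Type*} [Fintype ι] [DecidableEq ι]
    [Fintype κ] [DecidableEq κ] {α : ℝ} (hα : α ∈ Set.Icc (0 : ℝ) 1)
    (Φ : Matrix ι ι ℂ →ₚ[ℂ] Matrix (Fin l) (Fin l) ℂ)
    (Ψ : Matrix κ κ ℂ →ₚ[ℂ] Matrix (Fin l) (Fin l) ℂ)
    {a b : ℝ} (ha : 0 < a) (hb : 0 < b) (hΦ : Φ 1 ≤ a • (1 : Matrix (Fin l) (Fin l) ℂ))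
    (hΨ : Ψ 1 ≤ b • (1 : Matrix (Fin l) (Fin l) ℂ)) {A : Matrix ι ι ℂ} (hA : A.PosSemidef)
    {B : Matrix κ κ ℂ} (hB : B.PosSemidef) {m : ℝ} (hm : 0 < m)
    (h : m • 1 ≤ (weightedGeomMean α (Φ A) (Ψ B)).compound k) {r : ℝ} (hr : 1 ≤ r) :
    m ^ r • 1 ≤ (scalarGeomMean α a b ^ (r - 1)) ^ k •
      (weightedGeomMean α (Φ (A ^ r)) (Ψ (B ^ r))).compound k := by
  have hr0 : 0 < r := by linarith
  have hc := scalarGeomMean_pos (α := α) ha hb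
  set c := scalarGeomMean α a b with hcdef
  have hΦA := Φ.apply_posSemidef hA
  have hΨB := Ψ.apply_posSemidef hB
  have hΦr := Φ.apply_posSemidef (Matrix.PosSemidef.rpow A r)
  have hΨr := Ψ.apply_posSemidef (Matrix.PosSemidef.rpow B r)
  have hlim := ((Matrix.continuous_compound (k := k)).tendsto _).comp
    (tendsto_weightedGeomMean hα hΦr hΨr)
  refine ge_of_tendsto (hlim.const_smul ((c ^ (r - 1)) ^ k)) ?_
  filter_upwards [self_mem_nhdsWithin] with ε hε
  have hε' : (0 : ℝ) < ε := hε
  have hX := hΦr.isStrictlyPositive_add_smul_one hε'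
  have hY := hΨr.isStrictlyPositive_add_smul_one hε'
  have hleA := Φ.apply_le_smul_rpow ha hΦ hA hr hε'
  have hleB := Ψ.apply_le_smul_rpow hb hΨ hB hr hε'
  simp only [Function.comp]
  set X := Φ (A ^ r) + ε • 1
  set Y := Ψ (B ^ r) + ε • 1
  have hX0 := hX.pos_smul (inv_pos.2 ha)
  have hY0 := hY.pos_smul (inv_pos.2 hb)
  have hU := hX0.cfc_rpow r⁻¹
  have hV := hY0.cfc_rpow r⁻¹
  have h1 := weightedGeomMean_le_strictGeomMean hα hΦA hΨB (hU.pos_smul ha) (hV.pos_smul hb)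
    hleA hleB
  have h2 := h.trans (Matrix.compound_mono
    (Matrix.nonneg_iff_posSemidef.2 (posSemidef_weightedGeomMean hα hΦA hΨB))
    (isStrictlyPositive_strictGeomMean (hU.pos_smul ha) (hV.pos_smul hb)) h1)
  rw [strictGeomMean_smul α hU hV ha hb, Matrix.compound_real_smul, ← hcdef] at h2
  have hck : 0 < c ^ k := pow_pos hc k
  have h3 := smul_le_smul_of_nonneg_left h2 (inv_pos.2 hck).le
  rw [smul_smul, smul_smul, inv_mul_cancel₀ hck.ne', one_smul] at h3
  have h4 := rpow_smul_one_le_compound_strictGeomMean hα hU hV (by positivity) h3 hr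
  -- The outer power `r` cancels the Jensen power `1/r`, leaving `a⁻¹ • X` and `b⁻¹ • Y`, whose mean
  -- carries only one factor `c⁻¹`. Against the `r` factors paid before, this leaves `c ^ (r - 1)`
  -- in each of the `k` dimensions.
  rw [CFC.rpow_rpow _ _ _ (inv_pos.2 hr0).ne' hX0, CFC.rpow_rpow _ _ _ (inv_pos.2 hr0).ne' hY0,
    inv_mul_cancel₀ hr0.ne', CFC.rpow_one _ hX0.nonneg, CFC.rpow_one _ hY0.nonneg,
    strictGeomMean_smul α hX hY (inv_pos.2 ha) (inv_pos.2 hb), scalarGeomMean_inv α ha hb,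
    Matrix.compound_real_smul, ← hcdef] at h4
  have h5 := smul_le_smul_of_nonneg_left h4 (show 0 ≤ (c ^ k) ^ r by positivity)
  rw [smul_smul, smul_smul, Real.mul_rpow (by positivity) hm.le, Real.inv_rpow hck.le,
    mul_inv_cancel_left₀ (by positivity)] at h5
  refine h5.trans_eq ?_
  congr 1
  rw [inv_pow, Real.rpow_pow_comm hc.le, Real.rpow_sub hck, Real.rpow_one, div_eq_mul_inv]

theorem eigenvaluesDesc_nonneg {ι : Type*} [Fintype ι] [DecidableEq ι] {H : Matrix ι ι ℂ}
    (hH : H.PosSemidef) (i : Fin (Fintype.card ι)) : 0 ≤ eigenvaluesDesc H i := by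
  rw [eigenvaluesDesc_eq hH.isHermitian]
  have := hH.eigenvalues_nonneg (Fintype.equivOfCardEq (Fintype.card_fin _) i)
  rwa [Matrix.IsHermitian.eigenvalues, Equiv.symm_apply_apply] at this

/-- The slack `δ` provides a strictly positive constant even if `Φ 1 = 0`. -/
theorem PositiveLinearMap.apply_one_le_smul {ι κ : Type*} [Fintype ι] [DecidableEq ι] [Fintype κ]
    [DecidableEq κ] (Φ : Matrix ι ι ℂ →ₚ[ℂ] Matrix κ κ ℂ) {δ : ℝ} (hδ : 0 ≤ δ) :
    Φ 1 ≤ (‖Φ 1‖ + δ) • (1 : Matrix κ κ ℂ) := by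
  have h := (Φ.map_nonneg (zero_le_one (α := Matrix ι ι ℂ))).isSelfAdjoint.le_algebraMap_norm_self
  rw [Algebra.algebraMap_eq_smul_one] at h
  refine h.trans (smul_le_smul_of_nonneg_right ?_ zero_le_one)
  linarith

theorem prod_eigenvaluesDesc_rpow_le {ι κ : Type*} [Fintype ι] [DecidableEq ι]
    [Fintype κ] [DecidableEq κ] {α : ℝ} (hα : α ∈ Set.Icc (0 : ℝ) 1)
    (Φ : Matrix ι ι ℂ →ₚ[ℂ] Matrix (Fin l) (Fin l) ℂ)
    (Ψ : Matrix κ κ ℂ →ₚ[ℂ] Matrix (Fin l) (Fin l) ℂ) {A : Matrix ι ι ℂ} (hA : A.PosSemidef)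
    {B : Matrix κ κ ℂ} (hB : B.PosSemidef) (hk1 : 1 ≤ k) (hk : k ≤ Fintype.card (Fin l))
    {r : ℝ} (hr : 1 ≤ r) :
    (∏ i ∈ Finset.univ.filter (fun i : Fin (Fintype.card (Fin l)) =>
        Fintype.card (Fin l) - k ≤ (i : ℕ)),
        eigenvaluesDesc (weightedGeomMean α (Φ A) (Ψ B)) i) ^ r ≤
      (scalarGeomMean α ‖Φ 1‖ ‖Ψ 1‖ ^ (r - 1)) ^ k *
        ∏ i ∈ Finset.univ.filter (fun i : Fin (Fintype.card (Fin l)) =>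
          Fintype.card (Fin l) - k ≤ (i : ℕ)),
          eigenvaluesDesc (weightedGeomMean α (Φ (A ^ r)) (Ψ (B ^ r))) i := by
  have hW := posSemidef_weightedGeomMean hα (Φ.apply_posSemidef hA) (Ψ.apply_posSemidef hB)
  have hW' := posSemidef_weightedGeomMean hα (Φ.apply_posSemidef (Matrix.PosSemidef.rpow A r))
    (Ψ.apply_posSemidef (Matrix.PosSemidef.rpow B r))
  have key := hW.smul_one_le_compound_iff hk1 hk
  have key' := hW'.smul_one_le_compound_iff hk1 hk
  have hm0 := Finset.prod_nonneg (s := Finset.univ.filter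
    (fun i : Fin (Fintype.card (Fin l)) => Fintype.card (Fin l) - k ≤ (i : ℕ)))
    fun i _ => eigenvaluesDesc_nonneg hW i
  have hm0' := Finset.prod_nonneg (s := Finset.univ.filter
    (fun i : Fin (Fintype.card (Fin l)) => Fintype.card (Fin l) - k ≤ (i : ℕ)))
    fun i _ => eigenvaluesDesc_nonneg hW' i
  set m := ∏ i ∈ Finset.univ.filter (fun i : Fin (Fintype.card (Fin l)) =>
    Fintype.card (Fin l) - k ≤ (i : ℕ)), eigenvaluesDesc (weightedGeomMean α (Φ A) (Ψ B)) i
  set m' := ∏ i ∈ Finset.univ.filter (fun i : Fin (Fintype.card (Fin l)) =>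
    Fintype.card (Fin l) - k ≤ (i : ℕ)),
    eigenvaluesDesc (weightedGeomMean α (Φ (A ^ r)) (Ψ (B ^ r))) i
  have hs0 : 0 ≤ scalarGeomMean α ‖Φ 1‖ ‖Ψ 1‖ := by unfold scalarGeomMean; positivity
  -- Ando-Hiai is applied after dividing by `m`, so a zero product is treated apart; the left side
  -- is then 0.
  rcases hm0.eq_or_lt with hm | hm
  · rw [← hm, Real.zero_rpow (by linarith)]
    exact mul_nonneg (pow_nonneg (Real.rpow_nonneg hs0 _) _) hm0'
  refine ge_of_tendsto (tendsto_scalarGeomMean_add hα ‖Φ 1‖ ‖Ψ 1‖ m' k (sub_nonneg.2 hr)) ?_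
  filter_upwards [self_mem_nhdsWithin] with δ hδ
  have hδ' : (0 : ℝ) < δ := hδ
  have ha : 0 < ‖Φ 1‖ + δ := by positivity
  have hb : 0 < ‖Ψ 1‖ + δ := by positivity
  have h1 := rpow_smul_one_le_compound_weightedGeomMean (k := k) hα Φ Ψ ha hb
    (Φ.apply_one_le_smul hδ'.le) (Ψ.apply_one_le_smul hδ'.le) hA hB hm ((key m).2 le_rfl) hr
  have hc : 0 < (scalarGeomMean α (‖Φ 1‖ + δ) (‖Ψ 1‖ + δ) ^ (r - 1)) ^ k :=
    pow_pos (Real.rpow_pos_of_pos (scalarGeomMean_pos ha hb) _) k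
  have h2 := smul_le_smul_of_nonneg_left h1 (inv_pos.2 hc).le
  rw [smul_smul, smul_smul, inv_mul_cancel₀ hc.ne', one_smul] at h2
  exact (inv_mul_le_iff₀ hc).1 ((key' _).1 h2)

end WeightedGeomMean

/-! ### The log-supermajorization -/

theorem proposition4p2 (n m l : ℕ)
    (Φ : Matrix (Fin n) (Fin n) ℂ →ₚ[ℂ] Matrix (Fin l) (Fin l) ℂ)
    (Ψ : Matrix (Fin m) (Fin m) ℂ →ₚ[ℂ] Matrix (Fin l) (Fin l) ℂ)
    (α : ℝ) (hα : α ∈ Set.Icc (0 : ℝ) 1)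
    (A : Matrix (Fin n) (Fin n) ℂ) (hA : A.PosSemidef)
    (B : Matrix (Fin m) (Fin m) ℂ) (hB : B.PosSemidef) :
    (∀ r : ℝ, 1 ≤ r →
      LogSupermajorizedBy
        (fun i => scalarGeomMean α ‖Φ 1‖ ‖Ψ 1‖ ^ (r - 1) *
          eigenvaluesDesc (weightedGeomMean α (Φ (A ^ r)) (Ψ (B ^ r))) i)
        (fun i => eigenvaluesDesc (weightedGeomMean α (Φ A) (Ψ B)) i ^ r)) ∧
    (scalarGeomMean α ‖Φ 1‖ ‖Ψ 1‖ ≤ 1 → ∀ r : ℝ, 1 ≤ r →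
      LogSupermajorizedBy
        (eigenvaluesDesc (weightedGeomMean α (Φ (A ^ r)) (Ψ (B ^ r))))
        (fun i => eigenvaluesDesc (weightedGeomMean α (Φ A) (Ψ B)) i ^ r)) := by
  have hW := posSemidef_weightedGeomMean hα (Φ.apply_posSemidef hA) (Ψ.apply_posSemidef hB)
  have first : ∀ r : ℝ, 1 ≤ r →
      LogSupermajorizedBy
        (fun i => scalarGeomMean α ‖Φ 1‖ ‖Ψ 1‖ ^ (r - 1) *
          eigenvaluesDesc (weightedGeomMean α (Φ (A ^ r)) (Ψ (B ^ r))) i)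
        (fun i => eigenvaluesDesc (weightedGeomMean α (Φ A) (Ψ B)) i ^ r) := by
    intro r hr k hk1 hk
    rw [Real.finsetProd_rpow _ _ fun i _ => eigenvaluesDesc_nonneg hW i,
      Finset.prod_mul_distrib, Finset.prod_const, card_filter_sub_le hk]
    exact prod_eigenvaluesDesc_rpow_le hα Φ Ψ hA hB hk1 hk hr
  refine ⟨first, fun hc r hr k hk1 hk => (first r hr k hk1 hk).trans ?_⟩
  have hW' := posSemidef_weightedGeomMean hα (Φ.apply_posSemidef (Matrix.PosSemidef.rpow A r))
    (Ψ.apply_posSemidef (Matrix.PosSemidef.rpow B r))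
  have hs0 : 0 ≤ scalarGeomMean α ‖Φ 1‖ ‖Ψ 1‖ := by unfold scalarGeomMean; positivity
  -- The scalar factor is a power of a number in `[0, 1]` with exponent `r - 1 ≥ 0`, so dropping it
  -- only enlarges each entry.
  refine Finset.prod_le_prod (fun i _ => mul_nonneg (Real.rpow_nonneg hs0 _)
    (eigenvaluesDesc_nonneg hW' i)) fun i _ => ?_
  exact mul_le_of_le_one_left (eigenvaluesDesc_nonneg hW' i)
    (Real.rpow_le_one hs0 hc (by linarith))
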